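/- Let $L$ be a separable infinite-dimensional complex Hilbert space, $\mathcal B=\mathcal B(L)$ the algebra of bounded operators and $\mathcal K=\mathcal K(L)$ the space of compact operators on $L$. For a complex linear space $E$ let $\mathcal KE:=\mathcal K\otimes E$ (algebraic tensor product), a $\mathcal B$-bimodule by $a\cdot(b\otimes x)=(ab)\otimes x$ and $(b\otimes x)\cdot a=(ba)\otimes x$. A self-adjoint idempotent $P\in\mathcal B$ is a support of $u\in\mathcal KE$ if $P\cdot u=u=u\cdot P$. A quantum norm on $E$ is a norm on $\mathcal KE$ such that $\|a\cdot u\|\le\|a\|\|u\|$ and $\|u\cdot a\|\le\|a\|\|u\|$ for all $a\in\mathcal B$, $u\in\mathcal KE$, and $\|u+v\|=\max\{\|u\|,\|v\|\}$ whenever $u,v\in\mathcal KE$ have supports $P,Q$ with $PQ=0$. Fix a unitary operator $\iota$ from $L$ onto the Hilbert tensor product $L\mathbin{\dot\otimes}L$ and put $a\diamond b:=\iota^*(a\mathbin{\dot\otimes}b)\iota$ for $a,b\in\mathcal K$; this is again a compact operator. Let $E$ and $F$ be complex linear spaces equipped with quantum norms. Let $\odot$ and $\diamond$ be the bilinear maps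 $\mathcal KE\times\mathcal KF\to\mathcal K(E\otimes F)$ determined by $(a\otimes x)\odot(b\otimes y)=(ab)\otimes(x\otimes y)$ and $(a\otimes x)\diamond(b\otimes y)=(a\diamond b)\otimes(x\otimes y)$. For $U\in\mathcal K(E\otimes F)$ put $$\|U\|_h:=\inf\Big\{\sum_{k=1}^n\|u_k\|\|v_k\| : U=\sum_{k=1}^n u_k\odot v_k,\ u_k\in\mathcal KE,\ v_k\in\mathcal KF\Big\},$$ $$\|U\|_4:=\inf\Big\{\sum_{k=1}^n\|a_k\|\|u_k\|\|v_k\|\|b_k\| : U=\sum_{k=1}^n a_k\cdot(u_k\diamond v_k)\cdot b_k,\ a_k,b_k\in\mathcal K,\ u_k\in\mathcal KE,\ v_k\in\mathcal KF\Big\}.$$ Then $\|U\|_h\le\|U\|_4$ for every $U\in\mathcal K(E\otimes F)$, and $\|\cdot\|_4$ is a norm on $\mathcal K(E\otimes F)$. -/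

import Mathlib

open scoped TensorProduct

namespace QuantumTensor

/-! ### Compact operators and the Hilbert tensor product of operators -/

section Hilbert

variable {L : Type*} [NormedAddCommGroup L] [InnerProductSpace ℂ L]

/-- The Hilbert tensor product of two copies of `L`: the completion of the algebraic tensor
product in the norm of the inner product `⟪ξ ⊗ η, ξ' ⊗ η'⟫ = ⟪ξ, ξ'⟫ ⟪η, η'⟫`. -/
abbrev HilbertSquare (L : Type*) [NormedAddCommGroup L] [InnerProductSpace ℂ L] : Type _ :=
  UniformSpace.Completion (L ⊗[ℂ] L)

/-- The Hilbert tensor product of two bounded operators: the continuous extension of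
`ξ ⊗ η ↦ a ξ ⊗ b η`. -/
noncomputable def opTensor (a b : L →L[ℂ] L) : HilbertSquare L →L[ℂ] HilbertSquare L :=
  (TensorProduct.mapL a b).completion

theorem opTensor_coe (a b : L →L[ℂ] L) (x : L ⊗[ℂ] L) :
    opTensor a b (x : HilbertSquare L) = ((TensorProduct.mapL a b x : L ⊗[ℂ] L) : HilbertSquare L) :=
  ContinuousLinearMap.completion_apply_coe _ _

theorem hilbertSquare_ext {f g : HilbertSquare L →L[ℂ] HilbertSquare L}
    (h : ∀ x : L ⊗[ℂ] L, f (x : HilbertSquare L) = g (x : HilbertSquare L)) : f = g := by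
  ext x
  exact UniformSpace.Completion.induction_on x (isClosed_eq f.continuous g.continuous) h

theorem opTensor_add_left (a a' b : L →L[ℂ] L) :
    opTensor (a + a') b = opTensor a b + opTensor a' b := by
  refine hilbertSquare_ext fun x => ?_
  simp only [add_apply, opTensor_coe, TensorProduct.mapL_add_left,
    UniformSpace.Completion.coe_add]

theorem opTensor_add_right (a b b' : L →L[ℂ] L) :
    opTensor a (b + b') = opTensor a b + opTensor a b' := by
  refine hilbertSquare_ext fun x => ?_
  simp only [add_apply, opTensor_coe, TensorProduct.mapL_add_right,
    UniformSpace.Completion.coe_add]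

theorem opTensor_smul_left (c : ℂ) (a b : L →L[ℂ] L) :
    opTensor (c • a) b = c • opTensor a b := by
  refine hilbertSquare_ext fun x => ?_
  simp only [smul_apply, opTensor_coe, TensorProduct.mapL_smul_left,
    UniformSpace.Completion.coe_smul]

theorem opTensor_smul_right (c : ℂ) (a b : L →L[ℂ] L) :
    opTensor a (c • b) = c • opTensor a b := by
  refine hilbertSquare_ext fun x => ?_
  simp only [smul_apply, opTensor_coe, TensorProduct.mapL_smul_right,
    UniformSpace.Completion.coe_smul]

theorem norm_opTensor_le (a b : L →L[ℂ] L) : ‖opTensor a b‖ ≤ ‖a‖ * ‖b‖ := by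
  refine ContinuousLinearMap.opNorm_le_bound _ (by positivity) fun x => ?_
  refine UniformSpace.Completion.induction_on x
    (isClosed_le (by fun_prop) (by fun_prop)) fun y => ?_
  rw [opTensor_coe, UniformSpace.Completion.norm_coe, UniformSpace.Completion.norm_coe]
  exact (ContinuousLinearMap.le_opNorm _ _).trans
    (mul_le_mul_of_nonneg_right (TensorProduct.norm_mapL_le a b) (norm_nonneg _))

theorem continuous_opTensor :
    Continuous fun p : (L →L[ℂ] L) × (L →L[ℂ] L) => opTensor p.1 p.2 := by
  have h : IsBoundedBilinearMap ℂ fun p : (L →L[ℂ] L) × (L →L[ℂ] L) => opTensor p.1 p.2 :=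
    { add_left := opTensor_add_left
      smul_left := opTensor_smul_left
      add_right := opTensor_add_right
      smul_right := opTensor_smul_right
      bound := ⟨1, one_pos, fun a b => by rw [one_mul]; exact norm_opTensor_le a b⟩ }
  exact h.continuous

/-- A bounded operator with values in a finite-dimensional subspace is compact. -/
theorem isCompactOperator_of_finite {X : Type*} [NormedAddCommGroup X] [NormedSpace ℂ X]
    (W : Submodule ℂ X) [FiniteDimensional ℂ W] (a : X →L[ℂ] X) (h : ∀ x, a x ∈ W) :
    IsCompactOperator a := by
  have : ProperSpace W := FiniteDimensional.proper ℂ W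
  have hc : IsCompactOperator (a.codRestrict W h) :=
    isCompactOperator_of_locallyCompactSpace_dom (a.codRestrict W h)
  exact hc.clm_comp W.subtypeL

/-- A compact operator on a Hilbert space is a norm limit of finite rank operators. -/
theorem mem_closure_finite_rank (a : L →L[ℂ] L) (ha : IsCompactOperator a) :
    a ∈ closure {a' : L →L[ℂ] L |
      ∃ W : Submodule ℂ L, FiniteDimensional ℂ W ∧ ∀ x, a' x ∈ W} := by
  rw [Metric.mem_closure_iff]
  intro ε hε
  have hc : TotallyBounded (a '' Metric.closedBall 0 1) :=
    (ha.isCompact_closure_image_closedBall 1).totallyBounded.subset subset_closure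
  obtain ⟨t, ht, hcov⟩ := Metric.totallyBounded_iff.1 hc (ε / 2) (half_pos hε)
  let W : Submodule ℂ L := Submodule.span ℂ t
  have : FiniteDimensional ℂ W := FiniteDimensional.span_of_finite ℂ ht
  refine ⟨W.starProjection ∘L a, ⟨W, inferInstance, fun x => by simp⟩, ?_⟩
  rw [dist_eq_norm]
  refine lt_of_le_of_lt (?_ : _ ≤ ε / 2) (half_lt_self hε)
  refine ContinuousLinearMap.opNorm_le_of_unit_norm (by positivity) fun x hx => ?_
  have hax : a x ∈ a '' Metric.closedBall 0 1 := ⟨x, by simp [hx], rfl⟩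
  obtain ⟨y, hy, hxy⟩ := Set.mem_iUnion₂.1 (hcov hax)
  have hyW : y ∈ W := Submodule.subset_span hy
  have := W.starProjection_minimal (y := a x)
  simp only [sub_apply, ContinuousLinearMap.comp_apply]
  rw [this]
  refine (ciInf_le ⟨0, ?_⟩ (⟨y, hyW⟩ : W)).trans ?_
  · rintro _ ⟨w, rfl⟩; positivity
  · rw [Metric.mem_ball, dist_eq_norm] at hxy
    exact hxy.le

/-- The Hilbert tensor product of two compact operators is compact. -/
theorem isCompactOperator_opTensor {a b : L →L[ℂ] L} (ha : IsCompactOperator a)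
    (hb : IsCompactOperator b) : IsCompactOperator (opTensor a b) := by
  have key : opTensor a b ∈
      closure {f : HilbertSquare L →L[ℂ] HilbertSquare L | IsCompactOperator f} := by
    refine map_mem_closure₂ (f := opTensor) continuous_opTensor
      (mem_closure_finite_rank a ha) (mem_closure_finite_rank b hb) ?_
    rintro a' ⟨V, hV, haV⟩ b' ⟨W, hW, hbW⟩
    let j : L ⊗[ℂ] L →ₗ[ℂ] HilbertSquare L :=
      (UniformSpace.Completion.toComplL : L ⊗[ℂ] L →L[ℂ] HilbertSquare L).toLinearMap
    let Z : Submodule ℂ (HilbertSquare L) :=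
      (LinearMap.range (TensorProduct.map V.subtype W.subtype)).map j
    have : FiniteDimensional ℂ Z := inferInstance
    refine isCompactOperator_of_finite Z _ fun x => ?_
    refine UniformSpace.Completion.induction_on x
      ((Submodule.closed_of_finiteDimensional Z).preimage (opTensor a' b').continuous) fun y => ?_
    rw [opTensor_coe]
    refine Submodule.mem_map_of_mem (f := j) ?_
    induction y with
    | zero => simp
    | add y z hy hz => rw [map_add]; exact Submodule.add_mem _ hy hz
    | tmul ξ η => exact ⟨⟨a' ξ, haV ξ⟩ ⊗ₜ ⟨b' η, hbW η⟩, rfl⟩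
  rwa [isClosed_setOfPred_isCompactOperator.closure_eq] at key

end Hilbert

/-! ### Amplifications and quantum norms -/

section Amplification

variable (L : Type*) [NormedAddCommGroup L] [InnerProductSpace ℂ L]

/-- The compact operators on `L`, as a subspace of the bounded operators, with the operator
norm. -/
abbrev Comp : Submodule ℂ (L →L[ℂ] L) := compactOperator (RingHom.id ℂ) L L

/-- The amplification of a linear space `E`: the algebraic tensor product of the compact
operators on `L` with `E`. -/
abbrev Amp (E : Type*) [AddCommGroup E] [Module ℂ E] : Type _ := Comp L ⊗[ℂ] E

variable {L} {E F : Type*} [AddCommGroup E] [Module ℂ E] [AddCommGroup F] [Module ℂ F]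

/-- Composition of compact operators, as a bilinear map. -/
noncomputable def compMul : Comp L →ₗ[ℂ] Comp L →ₗ[ℂ] Comp L :=
  LinearMap.mk₂ ℂ (fun a b => ⟨(a : L →L[ℂ] L) * (b : L →L[ℂ] L), a.2.comp_clm (b : L →L[ℂ] L)⟩)
    (fun _ _ _ => Subtype.ext (add_mul _ _ _)) (fun _ _ _ => Subtype.ext (smul_mul_assoc _ _ _))
    (fun _ _ _ => Subtype.ext (mul_add _ _ _)) (fun _ _ _ => Subtype.ext (mul_smul_comm _ _ _))

/-- The left outer multiplication `a · (b ⊗ x) = (a b) ⊗ x` by a bounded operator `a`. -/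
noncomputable def outerL (a : L →L[ℂ] L) : Amp L E →ₗ[ℂ] Amp L E :=
  ((LinearMap.mulLeft ℂ a).restrict (p := Comp L) (q := Comp L)
    fun _ hb => IsCompactOperator.clm_comp hb a).rTensor E

/-- The right outer multiplication `(b ⊗ x) · a = (b a) ⊗ x` by a bounded operator `a`. -/
noncomputable def outerR (a : L →L[ℂ] L) : Amp L E →ₗ[ℂ] Amp L E :=
  ((LinearMap.mulRight ℂ a).restrict (p := Comp L) (q := Comp L)
    fun _ hb => IsCompactOperator.comp_clm hb a).rTensor E

/-- `N` is a norm on the complex linear space `X`. -/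
structure IsNorm {X : Type*} [AddCommGroup X] [Module ℂ X] (N : X → ℝ) : Prop where
  nonneg : ∀ x, 0 ≤ N x
  eq_zero_iff : ∀ x, N x = 0 ↔ x = 0
  smul : ∀ (c : ℂ) (x : X), N (c • x) = ‖c‖ * N x
  add_le : ∀ x y, N (x + y) ≤ N x + N y

/-- The projection `P` (a self-adjoint idempotent) is a support of `u`. -/
def IsSupport [CompleteSpace L] (P : L →L[ℂ] L) (u : Amp L E) : Prop :=
  IsStarProjection P ∧ outerL P u = u ∧ outerR P u = u

/-- `N` is a quantum norm on `E`: a norm on the amplification of `E` that satisfies both axioms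
of Ruan. -/
structure IsQuantumNorm [CompleteSpace L] (N : Amp L E → ℝ) : Prop extends IsNorm N where
  outerL_le : ∀ (a : L →L[ℂ] L) (u : Amp L E), N (outerL a u) ≤ ‖a‖ * N u
  outerR_le : ∀ (a : L →L[ℂ] L) (u : Amp L E), N (outerR a u) ≤ ‖a‖ * N u
  add_eq_max : ∀ (P Q : L →L[ℂ] L) (u v : Amp L E), IsSupport P u → IsSupport Q v → P * Q = 0 →
    N (u + v) = max (N u) (N v)

/-- The strong amplification of the canonical bilinear map `E × F → E ⊗ F`:
`(a ⊗ x) ⊙ (b ⊗ y) = (a b) ⊗ (x ⊗ y)`. -/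
noncomputable def effros : Amp L E →ₗ[ℂ] Amp L F →ₗ[ℂ] Amp L (E ⊗[ℂ] F) :=
  TensorProduct.map₂ compMul (TensorProduct.mk ℂ E F)

/-- The operator `a ◇ b = ι* (a ⊗ b) ι` on `L`, for a unitary `ι` from `L` onto the Hilbert tensor
square of `L`. -/
noncomputable def opDiamond (ι : L ≃ₗᵢ[ℂ] HilbertSquare L) (a b : L →L[ℂ] L) : L →L[ℂ] L :=
  (ι.symm.toContinuousLinearEquiv : HilbertSquare L →L[ℂ] L) ∘L opTensor a b ∘L
    (ι.toContinuousLinearEquiv : L →L[ℂ] HilbertSquare L)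

/-- The operation `a ◇ b` on compact operators, as a bilinear map. -/
noncomputable def compDiamond (ι : L ≃ₗᵢ[ℂ] HilbertSquare L) :
    Comp L →ₗ[ℂ] Comp L →ₗ[ℂ] Comp L :=
  LinearMap.mk₂ ℂ
    (fun a b => ⟨opDiamond ι a b,
      ((isCompactOperator_opTensor a.2 b.2).comp_clm
        (ι.toContinuousLinearEquiv : L →L[ℂ] HilbertSquare L)).clm_comp
        (ι.symm.toContinuousLinearEquiv : HilbertSquare L →L[ℂ] L)⟩)
    (fun _ _ _ => Subtype.ext (by ext; simp [opDiamond, opTensor_add_left]))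
    (fun _ _ _ => Subtype.ext (by ext; simp [opDiamond, opTensor_smul_left]))
    (fun _ _ _ => Subtype.ext (by ext; simp [opDiamond, opTensor_add_right]))
    (fun _ _ _ => Subtype.ext (by ext; simp [opDiamond, opTensor_smul_right]))

/-- The weak amplification of the canonical bilinear map `E × F → E ⊗ F`:
`(a ⊗ x) ◇ (b ⊗ y) = (a ◇ b) ⊗ (x ⊗ y)`. -/
noncomputable def diamond (ι : L ≃ₗᵢ[ℂ] HilbertSquare L) :
    Amp L E →ₗ[ℂ] Amp L F →ₗ[ℂ] Amp L (E ⊗[ℂ] F) :=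
  TensorProduct.map₂ (compDiamond ι) (TensorProduct.mk ℂ E F)

/-- The Haagerup norm: the infimum of `∑ ‖u k‖ ‖v k‖` over all `U = ∑ u k ⊙ v k`. -/
noncomputable def haagerupNorm (NE : Amp L E → ℝ) (NF : Amp L F → ℝ)
    (U : Amp L (E ⊗[ℂ] F)) : ℝ :=
  sInf {r : ℝ | ∃ (n : ℕ) (u : Fin n → Amp L E) (v : Fin n → Amp L F),
    U = ∑ k, effros (u k) (v k) ∧ r = ∑ k, NE (u k) * NF (v k)}

/-- The four-named norm: the infimum of `∑ ‖a k‖ ‖u k‖ ‖v k‖ ‖b k‖` over all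
`U = ∑ a k · (u k ◇ v k) · b k` with compact `a k`, `b k`. -/
noncomputable def fourNorm (ι : L ≃ₗᵢ[ℂ] HilbertSquare L) (NE : Amp L E → ℝ) (NF : Amp L F → ℝ)
    (U : Amp L (E ⊗[ℂ] F)) : ℝ :=
  sInf {r : ℝ | ∃ (n : ℕ) (a : Fin n → Comp L) (u : Fin n → Amp L E) (v : Fin n → Amp L F)
    (b : Fin n → Comp L),
    U = ∑ k, outerL (a k : L →L[ℂ] L) (outerR (b k : L →L[ℂ] L) (diamond ι (u k) (v k))) ∧
    r = ∑ k, ‖a k‖ * NE (u k) * NF (v k) * ‖b k‖}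

end Amplification

end QuantumTensor

/-!
Both norms are infima over representations of `U`, and everything rests on comparing single terms
through the identity `a · (u ◇ v) · b = (a · (u ◇ 1)) ⊙ ((1 ◇ v) · b)` (`outerL_outerR_diamond`).
The two factors on the right are honest elements of the amplifications, since `a` and `b` are
compact, and the inequality `‖·‖_h ≤ ‖·‖_4` follows from `‖a · (u ◇ 1)‖ ≤ ‖a‖ ‖u‖` and its mirror
image. Here `u ◇ 1` is the limit of `u ◇ p` for finite rank projections `p`. With
`Sᵢ ξ = ι* (ξ ⊗ eᵢ)` for an orthonormal basis `e`, the element `u ◇ p` is a finite sum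
`∑ᵢ Sᵢ · u · Sᵢ*` of copies of `u` with orthogonal supports, so its norm is at most `‖u‖` by Ruan's
second axiom (`IsQuantumNorm.inflate_le`). Since `a` is compact, `a (1 ◇ p) → a` in the operator
norm. The passage to the limit needs `b ↦ ‖b ⊗ x‖` to be bounded by a multiple of `‖b‖` for fixed
`x`, which is a gliding hump argument (`IsQuantumNorm.exists_tmul_le`).

Subadditivity of `‖·‖_4` amounts to the existence of representations (`fourSums_nonempty`), hence
to the factorization of a compact operator into three compact operators
(`exists_compact_mul_mul`).

For definiteness it is enough that the smaller norm `‖·‖_h` is definite. A functional on `E` that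
is contractive for the norm `x ↦ ‖p ⊗ x‖`, with `p` a rank one projection, is completely contractive
(`IsQuantumNorm.norm_amplFunctional_le`). So for two such functionals `f` on `E` and `g` on `F` the
operator `(id ⊗ f ⊗ g) U` has norm at most `‖U‖_h`, and by the Hahn–Banach theorem these operators
determine `U`.
-/

open scoped TensorProduct

namespace QuantumTensor

/-! ### Compact operators and isometries with orthogonal ranges -/

section IsometryFamily

variable {L : Type*} [NormedAddCommGroup L] [InnerProductSpace ℂ L] [CompleteSpace L]
variable {κ : Type*}

/-- A family of isometries of `L` with mutually orthogonal ranges. -/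
structure IsIsometryFamily (S : κ → L →L[ℂ] L) : Prop where
  star_mul_self : ∀ i, star (S i) * S i = 1
  star_mul_of_ne : ∀ i j, i ≠ j → star (S i) * S j = 0

/-- The projection onto the sum of the ranges of the isometries `S i`, `i ∈ s`. -/
noncomputable def rangeProj (S : κ → L →L[ℂ] L) (s : Finset κ) : L →L[ℂ] L :=
  ∑ i ∈ s, S i * star (S i)

namespace IsIsometryFamily

variable {S : κ → L →L[ℂ] L}

theorem norm_le (hS : IsIsometryFamily S) (i : κ) : ‖S i‖ ≤ 1 := by
  have h : ‖S i‖ * ‖S i‖ ≤ 1 := by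
    rw [← CStarRing.norm_star_mul_self, hS.star_mul_self]
    exact ContinuousLinearMap.norm_id_le
  nlinarith [norm_nonneg (S i)]

theorem rangeProj_mul_of_mem (hS : IsIsometryFamily S) {s : Finset κ} {j : κ} (hj : j ∈ s) :
    rangeProj S s * S j = S j := by
  rw [rangeProj, Finset.sum_mul, Finset.sum_eq_single_of_mem j hj]
  · rw [mul_assoc, hS.star_mul_self, mul_one]
  · intro i _ hij
    rw [mul_assoc, hS.star_mul_of_ne i j hij, mul_zero]

theorem rangeProj_mul_of_notMem (hS : IsIsometryFamily S) {s : Finset κ} {j : κ} (hj : j ∉ s) :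
    rangeProj S s * S j = 0 := by
  rw [rangeProj, Finset.sum_mul]
  refine Finset.sum_eq_zero fun i hi => ?_
  rw [mul_assoc, hS.star_mul_of_ne i j (ne_of_mem_of_not_mem hi hj), mul_zero]

theorem isStarProjection_rangeProj (hS : IsIsometryFamily S) (s : Finset κ) :
    IsStarProjection (rangeProj S s) := by
  refine ⟨?_, ?_⟩
  · change rangeProj S s * rangeProj S s = rangeProj S s
    conv_lhs => rw [rangeProj.eq_1 S s, Finset.mul_sum]
    refine Finset.sum_congr rfl fun i hi => ?_
    rw [← mul_assoc, ← rangeProj, hS.rangeProj_mul_of_mem hi]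
  · change star (rangeProj S s) = rangeProj S s
    simp [rangeProj, star_sum]

theorem norm_one_sub_rangeProj_le (hS : IsIsometryFamily S) (s : Finset κ) :
    ‖1 - rangeProj S s‖ ≤ 1 :=
  (hS.isStarProjection_rangeProj s).one_sub.norm_le

open Filter Topology in
/-- A compact operator is almost fixed by the projections `rangeProj S s` as soon as these
converge strongly to the identity. -/
theorem exists_norm_one_sub_rangeProj_mul_le (hS : IsIsometryFamily S)
    (hlim : ∀ y, Tendsto (fun s => rangeProj S s y) atTop (𝓝 y))
    {b : L →L[ℂ] L} (hb : IsCompactOperator b) {ε : ℝ} (hε : 0 < ε) :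
    ∃ s, ‖(1 - rangeProj S s) * b‖ ≤ ε := by
  have hc : TotallyBounded (b '' Metric.closedBall 0 1) :=
    (hb.isCompact_closure_image_closedBall 1).totallyBounded.subset subset_closure
  obtain ⟨t, ht, hcov⟩ := Metric.totallyBounded_iff.1 hc (ε / 2) (half_pos hε)
  have hev : ∀ᶠ s in atTop, ∀ y ∈ t, dist (rangeProj S s y) y < ε / 2 :=
    (eventually_all_finite ht).2 fun y _ => Metric.tendsto_nhds.1 (hlim y) _ (half_pos hε)
  obtain ⟨s, hs⟩ := hev.exists
  refine ⟨s, ContinuousLinearMap.opNorm_le_of_unit_norm hε.le fun x hx => ?_⟩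
  have hbx : b x ∈ b '' Metric.closedBall 0 1 := ⟨x, by simp [hx], rfl⟩
  obtain ⟨y, hy, hxy⟩ := Set.mem_iUnion₂.1 (hcov hbx)
  rw [Metric.mem_ball, dist_eq_norm] at hxy
  have h1 : ‖(1 - rangeProj S s) (b x - y)‖ ≤ ε / 2 :=
    (ContinuousLinearMap.le_of_opNorm_le _ (hS.norm_one_sub_rangeProj_le s) _).trans
      (by rw [one_mul]; exact hxy.le)
  have h2 : ‖(1 - rangeProj S s) y‖ ≤ ε / 2 := by
    have := (hs y hy).le
    rwa [dist_comm, dist_eq_norm] at this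
  have h3 : ((1 - rangeProj S s) * b) x
      = (1 - rangeProj S s) (b x - y) + (1 - rangeProj S s) y := by
    rw [← map_add, sub_add_cancel]; rfl
  rw [h3]
  linarith [norm_add_le ((1 - rangeProj S s) (b x - y)) ((1 - rangeProj S s) y)]

end IsIsometryFamily

/-- The adjoint of a compact operator on a Hilbert space is compact (Schauder). -/
theorem isCompactOperator_star {a : L →L[ℂ] L} (ha : IsCompactOperator a) :
    IsCompactOperator (star a : L →L[ℂ] L) := by
  have key : star a ∈ closure {f : L →L[ℂ] L | IsCompactOperator f} := by
    refine map_mem_closure continuous_star (mem_closure_finite_rank a ha) ?_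
    rintro a' ⟨W, hW, haW⟩
    have h : W.starProjection * a' = a' := by
      ext x
      exact Submodule.starProjection_eq_self_iff.2 (haW x)
    have h' : star a' = star a' * W.starProjection := by
      conv_lhs => rw [← h, star_mul, isSelfAdjoint_starProjection W]
    have hc : IsCompactOperator W.starProjection :=
      isCompactOperator_of_finite W _ fun x => by simp
    change IsCompactOperator (star a' : L →L[ℂ] L)
    rw [h']
    exact hc.clm_comp (star a' : L →L[ℂ] L)
  rwa [isClosed_setOfPred_isCompactOperator.closure_eq] at key

theorem isCompactOperator_of_hasSum {f : κ → L →L[ℂ] L} {a : L →L[ℂ] L} (h : HasSum f a)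
    (hf : ∀ i, IsCompactOperator (f i)) : IsCompactOperator a := by
  have : a ∈ closure {f : L →L[ℂ] L | IsCompactOperator f} :=
    mem_closure_of_tendsto h (Filter.Eventually.of_forall fun s =>
      (compactOperator (RingHom.id ℂ) L L).sum_mem fun i _ => hf i)
  rwa [isClosed_setOfPred_isCompactOperator.closure_eq] at this

/-- The isometries of an infinite family allow an infinite block-diagonal sum of compact operators
of summable norms. -/
theorem exists_block_diagonal {S : ℕ → L →L[ℂ] L} (hS : IsIsometryFamily S)
    {b : ℕ → L →L[ℂ] L} (hb : ∀ k, IsCompactOperator (b k)) (hsum : Summable fun k => ‖b k‖) :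
    ∃ c : L →L[ℂ] L, IsCompactOperator c ∧ ∀ k, star (S k) * c * S k = b k := by
  have hs : Summable fun k => S k * b k * star (S k) := by
    refine Summable.of_norm_bounded hsum fun k => ?_
    calc ‖S k * b k * star (S k)‖ ≤ ‖S k‖ * ‖b k‖ * ‖star (S k)‖ :=
          (norm_mul_le _ _).trans (mul_le_mul_of_nonneg_right (norm_mul_le _ _) (norm_nonneg _))
      _ ≤ 1 * ‖b k‖ * 1 := by
          rw [norm_star]
          gcongr
          exacts [hS.norm_le k, hS.norm_le k]
      _ = ‖b k‖ := by ring
  refine ⟨_, isCompactOperator_of_hasSum hs.hasSum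
    fun k => ((hb k).comp_clm (star (S k))).clm_comp (S k), fun k => ?_⟩
  have h1 := (hs.hasSum.mul_left (star (S k))).mul_right (S k)
  refine h1.unique ?_
  have hval : star (S k) * (S k * b k * star (S k)) * S k = b k := by
    rw [show star (S k) * (S k * b k * star (S k)) * S k
      = (star (S k) * S k) * b k * (star (S k) * S k) by noncomm_ring, hS.star_mul_self]
    simp
  have h2 := hasSum_single (f := fun j => star (S k) * (S j * b j * star (S j)) * S k) k ?_
  · rwa [hval] at h2
  · intro j hj
    rw [show star (S k) * (S j * b j * star (S j)) * S k
      = (star (S k) * S j) * b j * (star (S j) * S k) by noncomm_ring,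
      hS.star_mul_of_ne _ _ hj.symm]
    simp

/-- A compact operator is the sum of a series of finite rank operators of rapidly decreasing
norms. -/
theorem exists_hasSum_finite_rank {a : L →L[ℂ] L} (ha : IsCompactOperator a) :
    ∃ c : ℕ → L →L[ℂ] L, HasSum c a ∧ (∃ C, ∀ k, ‖c k‖ ≤ C * (1 / 4) ^ k) ∧
      ∀ k, ∃ W : Submodule ℂ L, FiniteDimensional ℂ W ∧ ∀ x, c k x ∈ W := by
  have happ : ∀ k : ℕ, ∃ f : L →L[ℂ] L,
      (∃ W : Submodule ℂ L, FiniteDimensional ℂ W ∧ ∀ x, f x ∈ W) ∧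
        ‖a - f‖ ≤ (1 / 4) ^ k := by
    intro k
    obtain ⟨f, hf, h⟩ := Metric.mem_closure_iff.1 (mem_closure_finite_rank a ha) ((1 / 4) ^ k)
      (by positivity)
    exact ⟨f, hf, by rw [← dist_eq_norm]; exact h.le⟩
  choose f hf hfa using happ
  have hlim : Filter.Tendsto f Filter.atTop (nhds a) := by
    rw [tendsto_iff_norm_sub_tendsto_zero]
    refine squeeze_zero (fun _ => norm_nonneg _) (fun k => by rw [norm_sub_rev]; exact hfa k)
      (tendsto_pow_atTop_nhds_zero_of_lt_one (by norm_num) (by norm_num))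
  let c : ℕ → L →L[ℂ] L := fun k => Nat.casesOn k (f 0) fun j => f (j + 1) - f j
  have hpart : ∀ n, ∑ k ∈ Finset.range (n + 1), c k = f n := by
    intro n
    induction n with
    | zero => simp [c]
    | succ n ih => rw [Finset.sum_range_succ, ih]; simp [c]
  have hnorm : ∀ k, ‖c k‖ ≤ (‖f 0‖ + 5) * (1 / 4) ^ k := by
    intro k
    cases k with
    | zero => simp [c]
    | succ j =>
      have h : c (j + 1) = (a - f j) - (a - f (j + 1)) := by simp [c]
      rw [h]
      refine (norm_sub_le _ _).trans ((add_le_add (hfa j) (hfa (j + 1))).trans ?_)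
      have : 0 ≤ ‖f 0‖ * (1 / 4 : ℝ) ^ (j + 1) := by positivity
      rw [add_mul]
      nlinarith [pow_succ (1 / 4 : ℝ) j]
  refine ⟨c, ?_, ⟨_, hnorm⟩, ?_⟩
  · have hs : Summable c := Summable.of_norm_bounded
      ((summable_geometric_of_lt_one (by norm_num) (by norm_num)).mul_left _) hnorm
    have h1 := (Filter.tendsto_add_atTop_iff_nat 1).2 hs.hasSum.tendsto_sum_nat
    rw [tendsto_nhds_unique (hlim.congr fun n => (hpart n).symm) h1]
    exact hs.hasSum
  · intro k
    cases k with
    | zero => exact hf 0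
    | succ j =>
      obtain ⟨V, hV, hfV⟩ := hf (j + 1)
      obtain ⟨W, hW, hfW⟩ := hf j
      exact ⟨V ⊔ W, inferInstance, fun x => Submodule.sub_mem _
        (Submodule.mem_sup_left (hfV x)) (Submodule.mem_sup_right (hfW x))⟩

/-- Every compact operator is a product of two compact operators. For `c = ∑ cₖ` with `cₖ` of
finite rank and `pₖ` the projection onto the range of `cₖ`, the factors are `∑ 2⁻ᵏ pₖ Sₖ*` and
`∑ 2ᵏ Sₖ cₖ`. -/
theorem exists_compact_mul {S : ℕ → L →L[ℂ] L} (hS : IsIsometryFamily S)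
    {c : L →L[ℂ] L} (hc : IsCompactOperator c) :
    ∃ a e : L →L[ℂ] L, IsCompactOperator a ∧ IsCompactOperator e ∧ a * e = c := by
  obtain ⟨d, hd, ⟨C, hC⟩, hW⟩ := exists_hasSum_finite_rank hc
  choose W hW hdW using hW
  let p : ℕ → L →L[ℂ] L := fun k => (W k).starProjection
  have hp : ∀ k, p k * d k = d k := fun k => by
    ext x
    exact Submodule.starProjection_eq_self_iff.2 (hdW k x)
  have hpc : ∀ k, IsCompactOperator (p k) := fun k =>
    isCompactOperator_of_finite (W k) _ fun x => by simp [p]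
  have hdc : ∀ k, IsCompactOperator (d k) := fun k => isCompactOperator_of_finite (W k) _ (hdW k)
  have ha : Summable fun k => ((1 / 2 : ℂ) ^ k) • (p k * star (S k)) := by
    refine Summable.of_norm_bounded (g := fun k => (1 / 2 : ℝ) ^ k)
      (summable_geometric_of_lt_one (by norm_num) (by norm_num)) fun k => ?_
    have h1 : ‖p k * star (S k)‖ ≤ 1 := by
      refine (norm_mul_le _ _).trans ?_
      rw [norm_star]
      exact mul_le_one₀ (Submodule.starProjection_norm_le _) (norm_nonneg _) (hS.norm_le k)
    rw [norm_smul, norm_pow]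
    simpa using mul_le_of_le_one_right (by positivity : (0 : ℝ) ≤ ((2 : ℝ) ^ k)⁻¹) h1
  have he : Summable fun k => ((2 : ℂ) ^ k) • (S k * d k) := by
    refine Summable.of_norm_bounded (g := fun k => C * (1 / 2 : ℝ) ^ k)
      ((summable_geometric_of_lt_one (by norm_num) (by norm_num)).mul_left _) fun k => ?_
    have h1 : ‖S k * d k‖ ≤ C * (1 / 4) ^ k := by
      refine (norm_mul_le _ _).trans (le_trans ?_ (hC k))
      exact mul_le_of_le_one_left (norm_nonneg _) (hS.norm_le k)
    rw [norm_smul, norm_pow]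
    have h2 : (1 / 2 : ℝ) ^ k = 2 ^ k * (1 / 4) ^ k := by rw [← mul_pow]; norm_num
    have h3 : ‖(2 : ℂ)‖ = 2 := by simp
    rw [h3, h2]
    nlinarith [mul_le_mul_of_nonneg_left h1 (by positivity : (0 : ℝ) ≤ 2 ^ k)]
  refine ⟨_, _, isCompactOperator_of_hasSum ha.hasSum fun k =>
      ((hpc k).comp_clm (star (S k))).smul _,
    isCompactOperator_of_hasSum he.hasSum fun k => ((hdc k).clm_comp (S k)).smul _, ?_⟩
  have haS : ∀ k, (∑' j, ((1 / 2 : ℂ) ^ j) • (p j * star (S j))) * S k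
      = ((1 / 2 : ℂ) ^ k) • p k := by
    intro k
    refine (ha.hasSum.mul_right (S k)).unique ?_
    have h2 := hasSum_single
      (f := fun j => ((1 / 2 : ℂ) ^ j) • (p j * star (S j)) * S k) k ?_
    · rwa [smul_mul_assoc, mul_assoc, hS.star_mul_self, mul_one] at h2
    · intro j hj
      rw [smul_mul_assoc, mul_assoc, hS.star_mul_of_ne _ _ hj, mul_zero, smul_zero]
  refine (he.hasSum.mul_left _).unique ?_
  convert! hd using 2 with k
  rw [mul_smul_comm, ← mul_assoc, haS, smul_mul_assoc, hp, smul_smul, ← mul_pow]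
  norm_num

/-- Every compact operator is a product of three compact operators. -/
theorem exists_compact_mul_mul {S : ℕ → L →L[ℂ] L} (hS : IsIsometryFamily S)
    {c : L →L[ℂ] L} (hc : IsCompactOperator c) :
    ∃ a e b : L →L[ℂ] L, IsCompactOperator a ∧ IsCompactOperator e ∧ IsCompactOperator b ∧
      a * e * b = c := by
  obtain ⟨a, f, ha, hf, rfl⟩ := exists_compact_mul hS hc
  obtain ⟨b, e, hb, he, h⟩ := exists_compact_mul hS (isCompactOperator_star hf)
  refine ⟨a, star e, star b, ha, isCompactOperator_star he, isCompactOperator_star hb, ?_⟩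
  rw [mul_assoc, ← star_mul, h, star_star]

/-- A Hilbert space of infinite dimension contains an infinite orthonormal sequence. -/
theorem exists_orthonormal_nat (hL : ¬ FiniteDimensional ℂ L) :
    ∃ e : ℕ → L, Orthonormal ℂ e := by
  obtain ⟨w, B, hB⟩ := exists_hilbertBasis ℂ L
  have hw : Infinite w := by
    by_contra h
    rw [not_infinite_iff_finite] at h
    have := Fintype.ofFinite w
    exact hL (Module.Basis.finiteDimensional_of_finite B.toOrthonormalBasis.toBasis)
  exact ⟨fun n => B (Infinite.natEmbedding w n),
    B.orthonormal.comp _ (Infinite.natEmbedding w).injective⟩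

end IsometryFamily

/-! ### Bilinear models of the Hilbert tensor square on the space itself -/

section HilbertTensor

variable {L : Type*} [NormedAddCommGroup L] [InnerProductSpace ℂ L]

/-- `β` identifies `L` with the Hilbert tensor product of `L` with itself: its inner products
are multiplicative and its values span a dense subspace. -/
structure IsHilbertTensor (β : L →ₗ[ℂ] L →ₗ[ℂ] L) : Prop where
  inner_apply : ∀ ξ η ξ' η', inner ℂ (β ξ η) (β ξ' η') = inner ℂ ξ ξ' * inner ℂ η η'
  dense_span : Dense (Submodule.span ℂ {y : L | ∃ ξ η, β ξ η = y} : Set L)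

namespace IsHilbertTensor

variable {β : L →ₗ[ℂ] L →ₗ[ℂ] L}

theorem flip (hβ : IsHilbertTensor β) : IsHilbertTensor β.flip where
  inner_apply ξ η ξ' η' := by
    rw [LinearMap.flip_apply, LinearMap.flip_apply, hβ.inner_apply, mul_comm]
  dense_span := by
    have h : {y : L | ∃ ξ η, β.flip ξ η = y} = {y : L | ∃ ξ η, β ξ η = y} :=
      Set.ext fun y => exists_comm
    rw [h]
    exact hβ.dense_span

theorem norm_apply (hβ : IsHilbertTensor β) (ξ η : L) : ‖β ξ η‖ = ‖ξ‖ * ‖η‖ := by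
  have h := hβ.inner_apply ξ η ξ η
  simp only [inner_self_eq_norm_sq_to_K] at h
  have h' : ‖β ξ η‖ ^ 2 = (‖ξ‖ * ‖η‖) ^ 2 := by
    rw [mul_pow]
    exact_mod_cast h
  exact (pow_left_inj₀ (norm_nonneg _) (by positivity) two_ne_zero).1 h'

/-- The operator `ξ ↦ β ξ e` that fixes the second tensor factor. -/
noncomputable def slot (hβ : IsHilbertTensor β) (e : L) : L →L[ℂ] L :=
  (β.flip e).mkContinuous ‖e‖ fun ξ => by
    rw [LinearMap.flip_apply, hβ.norm_apply, mul_comm]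

@[simp]
theorem slot_apply (hβ : IsHilbertTensor β) (e ξ : L) : hβ.slot e ξ = β ξ e := rfl

theorem ext (hβ : IsHilbertTensor β) {f g : L →L[ℂ] L} (h : ∀ ξ η, f (β ξ η) = g (β ξ η)) :
    f = g := by
  refine ContinuousLinearMap.ext_on hβ.dense_span ?_
  rintro _ ⟨ξ, η, rfl⟩
  exact h ξ η

theorem slot_mul (hβ : IsHilbertTensor β) {c A : L →L[ℂ] L}
    (hA : ∀ ξ η, A (β ξ η) = β (c ξ) η) (e : L) : hβ.slot e * c = A * hβ.slot e := by
  ext ξ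
  exact (hA ξ e).symm

variable [CompleteSpace L]

theorem star_slot_apply (hβ : IsHilbertTensor β) (e ξ η : L) :
    star (hβ.slot e) (β ξ η) = inner ℂ e η • ξ := by
  refine ext_inner_left ℂ fun v => ?_
  rw [ContinuousLinearMap.star_eq_adjoint, ContinuousLinearMap.adjoint_inner_right, slot_apply,
    hβ.inner_apply, inner_smul_right, mul_comm]

theorem isIsometryFamily_slot (hβ : IsHilbertTensor β) {κ : Type*} {e : κ → L}
    (he : Orthonormal ℂ e) : IsIsometryFamily fun i => hβ.slot (e i) where
  star_mul_self i := by
    ext ξ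
    change star (hβ.slot (e i)) (β ξ (e i)) = ξ
    rw [star_slot_apply, inner_self_eq_norm_sq_to_K, he.1 i]
    simp
  star_mul_of_ne i j hij := by
    ext ξ
    change star (hβ.slot (e i)) (β ξ (e j)) = 0
    rw [star_slot_apply, he.2 hij, zero_smul]

theorem mul_star_slot (hβ : IsHilbertTensor β) {c A : L →L[ℂ] L}
    (hA : ∀ ξ η, A (β ξ η) = β (c ξ) η) (e : L) :
    c * star (hβ.slot e) = star (hβ.slot e) * A := by
  refine hβ.ext fun ξ η => ?_
  change c (star (hβ.slot e) (β ξ η)) = star (hβ.slot e) (A (β ξ η))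
  rw [hA, star_slot_apply, star_slot_apply, map_smul]

open Filter Topology in
theorem tendsto_rangeProj_slot (hβ : IsHilbertTensor β) {κ : Type*} (B : HilbertBasis κ ℂ L)
    (y : L) : Tendsto (fun s => rangeProj (fun i => hβ.slot (B i)) s y) atTop (𝓝 y) := by
  have hfam := hβ.isIsometryFamily_slot B.orthonormal
  have hspan : ∀ y ∈ Submodule.span ℂ {y : L | ∃ ξ η, β ξ η = y},
      Tendsto (fun s => rangeProj (fun i => hβ.slot (B i)) s y) atTop (𝓝 y) := by
    intro y hy
    induction hy using Submodule.span_induction with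
    | mem y hy =>
      obtain ⟨ξ, η, rfl⟩ := hy
      have h1 := (B.hasSum_repr η).mapL (hβ.flip.slot ξ)
      have h2 : Tendsto (fun s => ∑ i ∈ s, hβ.flip.slot ξ (B.repr η i • B i)) atTop
        (𝓝 (β ξ η)) := h1
      refine h2.congr fun s => ?_
      rw [rangeProj, sum_apply]
      refine Finset.sum_congr rfl fun i _ => ?_
      change _ = hβ.slot (B i) (star (hβ.slot (B i)) (β ξ η))
      rw [star_slot_apply, map_smul, map_smul, B.repr_apply_apply]
      rfl
    | zero => simp
    | add y z _ _ hy hz => simpa using hy.add hz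
    | smul c y _ hy => simpa using hy.const_smul c
  rw [Metric.tendsto_nhds]
  intro ε hε
  obtain ⟨z, hz, hyz⟩ := Metric.mem_closure_iff.1 (hβ.dense_span y) (ε / 2) (half_pos hε)
  filter_upwards [Metric.tendsto_nhds.1 (hspan z hz) (ε / 2) (half_pos hε)] with s hs
  rw [dist_eq_norm] at hyz hs ⊢
  have h1 : ‖(1 - rangeProj (fun i => hβ.slot (B i)) s) (y - z)‖ ≤ ‖y - z‖ := by
    simpa using ContinuousLinearMap.le_of_opNorm_le _ (hfam.norm_one_sub_rangeProj_le s) (y - z)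
  have h2 : rangeProj (fun i => hβ.slot (B i)) s y - y
      = (rangeProj (fun i => hβ.slot (B i)) s z - z)
        - (1 - rangeProj (fun i => hβ.slot (B i)) s) (y - z) := by
    simp only [map_sub, sub_apply, one_apply_eq_self]
    abel
  rw [h2]
  linarith [norm_sub_le (rangeProj (fun i => hβ.slot (B i)) s z - z)
    ((1 - rangeProj (fun i => hβ.slot (B i)) s) (y - z))]

end IsHilbertTensor

end HilbertTensor

/-! ### Estimates in quantum normed spaces -/

section Amplification

variable {L : Type*} [NormedAddCommGroup L] [InnerProductSpace ℂ L]
variable {E F : Type*} [AddCommGroup E] [Module ℂ E] [AddCommGroup F] [Module ℂ F]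

/-- Left multiplication of compact operators by a bounded operator. -/
noncomputable def leftMul (a : L →L[ℂ] L) : Comp L →ₗ[ℂ] Comp L :=
  (LinearMap.mulLeft ℂ a).restrict (p := Comp L) (q := Comp L)
    fun _ hb => IsCompactOperator.clm_comp hb a

/-- Right multiplication of compact operators by a bounded operator. -/
noncomputable def rightMul (a : L →L[ℂ] L) : Comp L →ₗ[ℂ] Comp L :=
  (LinearMap.mulRight ℂ a).restrict (p := Comp L) (q := Comp L)
    fun _ hb => IsCompactOperator.comp_clm hb a

theorem coe_leftMul (a : L →L[ℂ] L) (c : Comp L) : (leftMul a c : L →L[ℂ] L) = a * c := rfl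

theorem coe_rightMul (a : L →L[ℂ] L) (c : Comp L) : (rightMul a c : L →L[ℂ] L) = c * a := rfl

theorem outerL_eq_rTensor (a : L →L[ℂ] L) :
    (outerL a : Amp L E →ₗ[ℂ] Amp L E) = (leftMul a).rTensor E := rfl

theorem outerR_eq_rTensor (a : L →L[ℂ] L) :
    (outerR a : Amp L E →ₗ[ℂ] Amp L E) = (rightMul a).rTensor E := rfl

theorem outerL_outerL (a b : L →L[ℂ] L) (u : Amp L E) :
    outerL a (outerL b u) = outerL (a * b) u := by
  have h : leftMul a ∘ₗ leftMul b = leftMul (a * b) :=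
    LinearMap.ext fun c => Subtype.ext (mul_assoc _ _ _).symm
  rw [outerL_eq_rTensor, outerL_eq_rTensor, outerL_eq_rTensor, ← LinearMap.rTensor_comp_apply, h]

theorem outerR_outerR (a b : L →L[ℂ] L) (u : Amp L E) :
    outerR a (outerR b u) = outerR (b * a) u := by
  have h : rightMul a ∘ₗ rightMul b = rightMul (b * a) :=
    LinearMap.ext fun c => Subtype.ext (mul_assoc _ _ _)
  rw [outerR_eq_rTensor, outerR_eq_rTensor, outerR_eq_rTensor, ← LinearMap.rTensor_comp_apply, h]

theorem outerR_outerL (a b : L →L[ℂ] L) (u : Amp L E) :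
    outerR a (outerL b u) = outerL b (outerR a u) := by
  have h : rightMul a ∘ₗ leftMul b = leftMul b ∘ₗ rightMul a :=
    LinearMap.ext fun c => Subtype.ext (mul_assoc _ _ _)
  rw [outerL_eq_rTensor, outerR_eq_rTensor, ← LinearMap.rTensor_comp_apply, h,
    LinearMap.rTensor_comp_apply]

namespace IsNorm

variable {X : Type*} [AddCommGroup X] [Module ℂ X] {N : X → ℝ}

theorem zero (hN : IsNorm N) : N 0 = 0 := (hN.eq_zero_iff 0).2 rfl

end IsNorm

section

variable [CompleteSpace L] {κ : Type*} {S : κ → L →L[ℂ] L} {N : Amp L E → ℝ}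

/-- The inflation `∑ᵢ Sᵢ · u · Sᵢ*` of an element of the amplification along isometries with
orthogonal ranges. -/
noncomputable def inflate (S : κ → L →L[ℂ] L) (s : Finset κ) (u : Amp L E) : Amp L E :=
  ∑ i ∈ s, outerL (S i) (outerR (star (S i)) u)

theorem IsIsometryFamily.isSupport_inflate (hS : IsIsometryFamily S) (s : Finset κ)
    (u : Amp L E) : IsSupport (rangeProj S s) (inflate S s u) := by
  have hP := hS.isStarProjection_rangeProj s
  refine ⟨hP, ?_, ?_⟩
  · rw [inflate, map_sum]
    refine Finset.sum_congr rfl fun i hi => ?_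
    rw [outerL_outerL, hS.rangeProj_mul_of_mem hi]
  · rw [inflate, map_sum]
    refine Finset.sum_congr rfl fun i hi => ?_
    have h : star (S i) * rangeProj S s = star (S i) := by
      have h := congrArg star (hS.rangeProj_mul_of_mem hi)
      rwa [star_mul, hP.isSelfAdjoint.star_eq] at h
    rw [outerR_outerL, outerR_outerR, h]

/-- Inflation does not increase a quantum norm, by the second axiom of Ruan. -/
theorem IsQuantumNorm.inflate_le (hN : IsQuantumNorm N) (hS : IsIsometryFamily S)
    (s : Finset κ) (u : Amp L E) : N (inflate S s u) ≤ N u := by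
  classical
  induction s using Finset.induction_on with
  | empty => simpa [inflate, hN.toIsNorm.zero] using hN.nonneg u
  | insert j s hj ih =>
    have hsum : inflate S (insert j s) u = inflate S {j} u + inflate S s u := by
      simp [inflate, Finset.sum_insert hj]
    have hort : rangeProj S {j} * rangeProj S s = 0 := by
      have h := congrArg star (hS.rangeProj_mul_of_notMem hj)
      rw [star_mul, (hS.isStarProjection_rangeProj s).isSelfAdjoint.star_eq, star_zero] at h
      rw [rangeProj, Finset.sum_singleton, mul_assoc, h, mul_zero]
    rw [hsum, hN.add_eq_max _ _ _ _ (hS.isSupport_inflate {j} u) (hS.isSupport_inflate s u) hort]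
    refine max_le ?_ ih
    rw [inflate, Finset.sum_singleton]
    calc N (outerL (S j) (outerR (star (S j)) u)) ≤ ‖S j‖ * (‖star (S j)‖ * N u) :=
          (hN.outerL_le _ _).trans
            (mul_le_mul_of_nonneg_left (hN.outerR_le _ _) (norm_nonneg _))
      _ ≤ 1 * (1 * N u) := by
          have h0 := hN.nonneg u
          rw [norm_star]
          gcongr
          exacts [hS.norm_le j, hS.norm_le j]
      _ = N u := by ring

/-- For fixed `x`, the map `b ↦ b ⊗ x` is bounded for the operator norm. Otherwise there are
`b k` with `‖b k‖ = 2⁻ᵏ` and `2ᵏ < N (b k ⊗ x)`, and the block-diagonal sum `c` of the `b k` would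
satisfy `2ᵏ < N (c ⊗ x)` for all `k`. -/
theorem IsQuantumNorm.exists_tmul_le (hN : IsQuantumNorm N) {S : ℕ → L →L[ℂ] L}
    (hS : IsIsometryFamily S) (x : E) :
    ∃ C, 0 ≤ C ∧ ∀ b : Comp L, N (b ⊗ₜ[ℂ] x) ≤ C * ‖b‖ := by
  by_contra! hcon
  choose b hb using fun k : ℕ => hcon (4 ^ k) (by positivity)
  have hpos : ∀ k, 0 < ‖b k‖ := fun k => by
    refine norm_pos_iff.2 fun h0 => ?_
    have := hb k
    rw [h0, TensorProduct.zero_tmul, hN.toIsNorm.zero, norm_zero, mul_zero] at this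
    exact lt_irrefl _ this
  let r : ℕ → ℝ := fun k => ((2 : ℝ) ^ k * ‖b k‖)⁻¹
  have hr : ∀ k, 0 < r k := fun k => inv_pos.2 (mul_pos (by positivity) (hpos k))
  have hnr : ∀ k, ‖(r k : ℂ)‖ = r k := fun k => by
    rw [Complex.norm_real, Real.norm_of_nonneg (hr k).le]
  let d : ℕ → Comp L := fun k => (r k : ℂ) • b k
  have hd : ∀ k, ‖d k‖ = (1 / 2) ^ k := fun k => by
    rw [norm_smul, hnr]
    have := (hpos k).ne'
    simp only [r]
    field_simp
    rw [← mul_pow]; norm_num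
  have hdN : ∀ k, (2 : ℝ) ^ k < N (d k ⊗ₜ[ℂ] x) := fun k => by
    rw [← TensorProduct.smul_tmul', hN.smul, hnr]
    have h4 : (4 : ℝ) ^ k = 2 ^ k * 2 ^ k := by rw [← mul_pow]; norm_num
    calc (2 : ℝ) ^ k = r k * (4 ^ k * ‖b k‖) := by
          have := (hpos k).ne'
          simp only [r]
          rw [h4]
          field_simp
      _ < _ := mul_lt_mul_of_pos_left (hb k) (hr k)
  obtain ⟨c, hc, hcd⟩ := exists_block_diagonal hS (b := fun k => (d k : L →L[ℂ] L))
    (fun k => (d k).2) (by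
      have : (fun k => ‖(d k : L →L[ℂ] L)‖) = fun k => (1 / 2 : ℝ) ^ k := funext hd
      rw [this]
      exact summable_geometric_of_lt_one (by norm_num) (by norm_num))
  obtain ⟨k, hk⟩ := pow_unbounded_of_one_lt (N ((⟨c, hc⟩ : Comp L) ⊗ₜ[ℂ] x))
    (one_lt_two : (1 : ℝ) < 2)
  have hdc : d k ⊗ₜ[ℂ] x
      = outerL (star (S k)) (outerR (S k) ((⟨c, hc⟩ : Comp L) ⊗ₜ[ℂ] x)) := by
    rw [outerL_eq_rTensor, outerR_eq_rTensor, LinearMap.rTensor_tmul, LinearMap.rTensor_tmul]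
    congr 1
    refine Subtype.ext ?_
    rw [coe_leftMul, coe_rightMul, ← hcd k, mul_assoc]
  have hle : N (d k ⊗ₜ[ℂ] x) ≤ 1 * (1 * N ((⟨c, hc⟩ : Comp L) ⊗ₜ[ℂ] x)) := by
    rw [hdc]
    refine (hN.outerL_le _ _).trans ?_
    rw [norm_star]
    have h0 := hN.nonneg ((⟨c, hc⟩ : Comp L) ⊗ₜ[ℂ] x)
    exact mul_le_mul (hS.norm_le k) ((hN.outerR_le _ _).trans
      (mul_le_mul_of_nonneg_right (hS.norm_le k) h0)) (hN.nonneg _) zero_le_one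
  linarith [hdN k]

/-- A map of coefficients that is small in norm makes a fixed element of the amplification
small. -/
theorem IsQuantumNorm.exists_rTensor_le (hN : IsQuantumNorm N) {S : ℕ → L →L[ℂ] L}
    (hS : IsIsometryFamily S) (u : Amp L E) :
    ∃ C, 0 ≤ C ∧ ∀ (t : ℝ) (T : Comp L →ₗ[ℂ] Comp L), (∀ c, ‖T c‖ ≤ t * ‖c‖) →
      N (T.rTensor E u) ≤ C * t := by
  induction u using TensorProduct.induction_on with
  | zero => exact ⟨0, le_rfl, fun t T _ => by simp [hN.toIsNorm.zero]⟩
  | tmul c x =>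
    obtain ⟨C, hC, h⟩ := hN.exists_tmul_le hS x
    refine ⟨C * ‖c‖, by positivity, fun t T hT => ?_⟩
    rw [LinearMap.rTensor_tmul]
    calc N (T c ⊗ₜ[ℂ] x) ≤ C * ‖T c‖ := h _
      _ ≤ C * (t * ‖c‖) := mul_le_mul_of_nonneg_left (hT c) hC
      _ = C * ‖c‖ * t := by ring
  | add u v hu hv =>
    obtain ⟨C, hC, h⟩ := hu
    obtain ⟨D, hD, h'⟩ := hv
    refine ⟨C + D, by positivity, fun t T hT => ?_⟩
    rw [map_add, add_mul]
    exact (hN.add_le _ _).trans (add_le_add (h t T hT) (h' t T hT))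

/-- A bound for coefficient maps passes to limits in the operator norm. -/
theorem IsQuantumNorm.rTensor_le_of_approx (hN : IsQuantumNorm N) {S : ℕ → L →L[ℂ] L}
    (hS : IsIsometryFamily S) {Φ : Comp L →ₗ[ℂ] Comp L} {K : ℝ} {u : Amp L E}
    (h : ∀ ε > 0, ∃ Ψ : Comp L →ₗ[ℂ] Comp L, (∀ c, ‖Φ c - Ψ c‖ ≤ ε * ‖c‖) ∧
      N (Ψ.rTensor E u) ≤ K) : N (Φ.rTensor E u) ≤ K := by
  obtain ⟨C, hC, hCT⟩ := hN.exists_rTensor_le hS u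
  refine le_of_forall_pos_le_add fun ε hε => ?_
  obtain ⟨Ψ, hΨ, hK⟩ := h (ε / (C + 1)) (by positivity)
  have h1 := hCT (ε / (C + 1)) (Φ - Ψ) hΨ
  have h2 : C * (ε / (C + 1)) ≤ ε := by
    rw [mul_div_assoc', div_le_iff₀ (by positivity)]
    nlinarith
  have h3 : Φ.rTensor E u = Ψ.rTensor E u + (Φ - Ψ).rTensor E u := by
    conv_lhs => rw [← add_sub_cancel Ψ Φ, LinearMap.rTensor_add, LinearMap.add_apply]
  rw [h3]
  linarith [hN.add_le (Ψ.rTensor E u) ((Φ - Ψ).rTensor E u)]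

theorem inflate_eq_rTensor (S : κ → L →L[ℂ] L) (s : Finset κ) (u : Amp L E) :
    inflate S s u = (∑ i ∈ s, leftMul (S i) ∘ₗ rightMul (star (S i))).rTensor E u := by
  induction u using TensorProduct.induction_on with
  | zero => simp [inflate]
  | tmul c x =>
    simp [inflate, outerL_eq_rTensor, outerR_eq_rTensor, TensorProduct.sum_tmul]
  | add u v hu hv => rw [map_add, ← hu, ← hv]; simp [inflate, Finset.sum_add_distrib]

variable {β : L →ₗ[ℂ] L →ₗ[ℂ] L}

theorem exists_isIsometryFamily_nat (hL : ¬ FiniteDimensional ℂ L) (hβ : IsHilbertTensor β) :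
    ∃ S : ℕ → L →L[ℂ] L, IsIsometryFamily S := by
  obtain ⟨e, he⟩ := exists_orthonormal_nat hL
  exact ⟨_, hβ.isIsometryFamily_slot he⟩

/-- If `A c` is the operator `c ⊗ 1` in the model `β` of the Hilbert tensor square, the
infinite amplification `c ↦ a (c ⊗ 1)`, cut down by a compact operator `a`, is bounded by `‖a‖`
for every quantum norm: it is the limit of the finite inflations
`c ↦ a (c ⊗ p) = a ∑ᵢ Sᵢ c Sᵢ*`. -/
theorem IsQuantumNorm.rTensor_mul_ampl_le (hN : IsQuantumNorm N) (hL : ¬ FiniteDimensional ℂ L)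
    (hβ : IsHilbertTensor β) {A : Comp L → L →L[ℂ] L} (hA1 : ∀ c, ‖A c‖ ≤ ‖c‖)
    (hA : ∀ c ξ η, A c (β ξ η) = β ((c : L →L[ℂ] L) ξ) η) (a : Comp L)
    {Φ : Comp L →ₗ[ℂ] Comp L} (hΦ : ∀ c, (Φ c : L →L[ℂ] L) = a * A c) (u : Amp L E) :
    N (Φ.rTensor E u) ≤ ‖a‖ * N u := by
  obtain ⟨S₀, hS₀⟩ := exists_isIsometryFamily_nat hL hβ
  obtain ⟨w, B, -⟩ := exists_hilbertBasis ℂ L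
  have hS := hβ.isIsometryFamily_slot B.orthonormal
  set S := fun i => hβ.slot (B i)
  refine hN.rTensor_le_of_approx hS₀ fun ε hε => ?_
  obtain ⟨s, hs⟩ := hS.exists_norm_one_sub_rangeProj_mul_le (hβ.tendsto_rangeProj_slot B)
    (isCompactOperator_star a.2) hε
  refine ⟨leftMul a ∘ₗ ∑ i ∈ s, leftMul (S i) ∘ₗ rightMul (star (S i)), fun c => ?_, ?_⟩
  · have h1 : ((leftMul (a : L →L[ℂ] L) ∘ₗ ∑ i ∈ s, leftMul (S i) ∘ₗ rightMul (star (S i))) c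
        : L →L[ℂ] L) = a * (rangeProj S s * A c) := by
      rw [LinearMap.comp_apply, coe_leftMul, LinearMap.sum_apply, AddSubmonoidClass.coe_finsetSum,
        rangeProj, Finset.sum_mul]
      congr 1
      refine Finset.sum_congr rfl fun i _ => ?_
      rw [LinearMap.comp_apply, coe_leftMul, coe_rightMul, mul_assoc,
        hβ.mul_star_slot (hA c) (B i)]
    have h2 : ‖(a : L →L[ℂ] L) * (1 - rangeProj S s)‖ ≤ ε := by
      rw [← norm_star, star_mul,
        ((hS.isStarProjection_rangeProj s).one_sub).isSelfAdjoint.star_eq]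
      exact hs
    rw [Submodule.coe_norm, AddSubgroupClass.coe_sub, h1, hΦ,
      show (a : L →L[ℂ] L) * A c - a * (rangeProj S s * A c)
        = a * (1 - rangeProj S s) * A c by noncomm_ring]
    exact (norm_mul_le _ _).trans (mul_le_mul h2 (hA1 c) (norm_nonneg _) hε.le)
  · rw [LinearMap.rTensor_comp_apply, ← inflate_eq_rTensor, ← outerL_eq_rTensor]
    exact (hN.outerL_le _ _).trans
      (mul_le_mul_of_nonneg_left (hN.inflate_le hS s u) (norm_nonneg _))

/-- The mirror image of `IsQuantumNorm.rTensor_mul_ampl_le`, with the compact operator on the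
right. -/
theorem IsQuantumNorm.rTensor_ampl_mul_le (hN : IsQuantumNorm N) (hL : ¬ FiniteDimensional ℂ L)
    (hβ : IsHilbertTensor β) {A : Comp L → L →L[ℂ] L} (hA1 : ∀ c, ‖A c‖ ≤ ‖c‖)
    (hA : ∀ c ξ η, A c (β ξ η) = β ((c : L →L[ℂ] L) ξ) η) (b : Comp L)
    {Φ : Comp L →ₗ[ℂ] Comp L} (hΦ : ∀ c, (Φ c : L →L[ℂ] L) = A c * b) (u : Amp L E) :
    N (Φ.rTensor E u) ≤ ‖b‖ * N u := by
  obtain ⟨S₀, hS₀⟩ := exists_isIsometryFamily_nat hL hβ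
  obtain ⟨w, B, -⟩ := exists_hilbertBasis ℂ L
  have hS := hβ.isIsometryFamily_slot B.orthonormal
  set S := fun i => hβ.slot (B i)
  refine hN.rTensor_le_of_approx hS₀ fun ε hε => ?_
  obtain ⟨s, hs⟩ := hS.exists_norm_one_sub_rangeProj_mul_le (hβ.tendsto_rangeProj_slot B)
    b.2 hε
  refine ⟨rightMul b ∘ₗ ∑ i ∈ s, leftMul (S i) ∘ₗ rightMul (star (S i)), fun c => ?_, ?_⟩
  · have h1 : ((rightMul (b : L →L[ℂ] L) ∘ₗ ∑ i ∈ s, leftMul (S i) ∘ₗ rightMul (star (S i))) c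
        : L →L[ℂ] L) = A c * rangeProj S s * b := by
      rw [LinearMap.comp_apply, coe_rightMul, LinearMap.sum_apply,
        AddSubmonoidClass.coe_finsetSum, rangeProj, Finset.mul_sum]
      congr 1
      refine Finset.sum_congr rfl fun i _ => ?_
      rw [LinearMap.comp_apply, coe_leftMul, coe_rightMul, ← mul_assoc,
        hβ.slot_mul (hA c) (B i), mul_assoc]
    rw [Submodule.coe_norm, AddSubgroupClass.coe_sub, h1, hΦ,
      show A c * b - A c * rangeProj S s * b
        = A c * ((1 - rangeProj S s) * b) by noncomm_ring, mul_comm ε]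
    exact (norm_mul_le _ _).trans (mul_le_mul (hA1 c) hs (norm_nonneg _) (norm_nonneg _))
  · rw [LinearMap.rTensor_comp_apply, ← inflate_eq_rTensor, ← outerR_eq_rTensor]
    exact (hN.outerR_le _ _).trans
      (mul_le_mul_of_nonneg_left (hN.inflate_le hS s u) (norm_nonneg _))

end

end Amplification

/-! ### Comparison of the two norms -/

section Comparison

variable {L : Type*} [NormedAddCommGroup L] [InnerProductSpace ℂ L]
variable {E F : Type*} [AddCommGroup E] [Module ℂ E] [AddCommGroup F] [Module ℂ F]
variable (ι : L ≃ₗᵢ[ℂ] HilbertSquare L)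

/-- The bilinear map `(ξ, η) ↦ ι* (ξ ⊗ η)`. -/
noncomputable def modelTensor : L →ₗ[ℂ] L →ₗ[ℂ] L :=
  (TensorProduct.mk ℂ L L).compr₂ (ι.symm.toLinearEquiv.toLinearMap ∘ₗ
    (UniformSpace.Completion.toComplL : L ⊗[ℂ] L →L[ℂ] HilbertSquare L).toLinearMap)

theorem modelTensor_apply (ξ η : L) :
    modelTensor ι ξ η = ι.symm ((ξ ⊗ₜ[ℂ] η : L ⊗[ℂ] L) : HilbertSquare L) := rfl

theorem isHilbertTensor_modelTensor : IsHilbertTensor (modelTensor ι) where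
  inner_apply ξ η ξ' η' := by
    rw [modelTensor_apply, modelTensor_apply, LinearIsometryEquiv.inner_map_map,
      UniformSpace.Completion.inner_coe, TensorProduct.inner_tmul]
  dense_span := by
    have h1 : DenseRange fun x : L ⊗[ℂ] L => ι.symm (x : HilbertSquare L) :=
      ι.symm.surjective.denseRange.comp UniformSpace.Completion.denseRange_coe
        ι.symm.continuous
    refine h1.mono ?_
    rintro _ ⟨x, rfl⟩
    change ι.symm (x : HilbertSquare L) ∈ Submodule.span ℂ _
    induction x using TensorProduct.induction_on with
    | zero =>
      rw [UniformSpace.Completion.coe_zero, map_zero]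
      exact Submodule.zero_mem _
    | tmul ξ η => exact Submodule.subset_span ⟨ξ, η, rfl⟩
    | add x y hx hy =>
      rw [UniformSpace.Completion.coe_add, map_add]
      exact Submodule.add_mem _ hx hy

theorem opDiamond_modelTensor (a b : L →L[ℂ] L) (ξ η : L) :
    opDiamond ι a b (modelTensor ι ξ η) = modelTensor ι (a ξ) (b η) := by
  change ι.symm (opTensor a b (ι (modelTensor ι ξ η))) = _
  rw [modelTensor_apply, LinearIsometryEquiv.apply_symm_apply, opTensor_coe]
  rfl

theorem norm_opDiamond_le (a b : L →L[ℂ] L) : ‖opDiamond ι a b‖ ≤ ‖a‖ * ‖b‖ := by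
  refine ContinuousLinearMap.opNorm_le_bound _ (by positivity) fun x => ?_
  change ‖ι.symm (opTensor a b (ι x))‖ ≤ _
  rw [LinearIsometryEquiv.norm_map, ← LinearIsometryEquiv.norm_map ι x]
  exact ContinuousLinearMap.le_of_opNorm_le _ (norm_opTensor_le a b) _

/-- The map `c ↦ a (c ◇ 1)` on compact operators, for a compact operator `a`. -/
noncomputable def mulAmpl (a : Comp L) : Comp L →ₗ[ℂ] Comp L where
  toFun c := ⟨a * opDiamond ι c 1, IsCompactOperator.comp_clm a.2 (opDiamond ι c 1)⟩
  map_add' _ _ := Subtype.ext (by ext; simp [opDiamond, opTensor_add_left])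
  map_smul' _ _ := Subtype.ext (by ext; simp [opDiamond, opTensor_smul_left])

/-- The map `c ↦ (1 ◇ c) b` on compact operators, for a compact operator `b`. -/
noncomputable def amplMul (b : Comp L) : Comp L →ₗ[ℂ] Comp L where
  toFun c := ⟨opDiamond ι 1 c * b, IsCompactOperator.clm_comp b.2 (opDiamond ι 1 c)⟩
  map_add' _ _ := Subtype.ext (by ext; simp [opDiamond, opTensor_add_right])
  map_smul' _ _ := Subtype.ext (by ext; simp [opDiamond, opTensor_smul_right])

theorem outerL_tmul (a : L →L[ℂ] L) (c : Comp L) (x : E) :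
    outerL a (c ⊗ₜ[ℂ] x) = leftMul a c ⊗ₜ[ℂ] x := rfl

theorem outerR_tmul (a : L →L[ℂ] L) (c : Comp L) (x : E) :
    outerR a (c ⊗ₜ[ℂ] x) = rightMul a c ⊗ₜ[ℂ] x := rfl

theorem effros_tmul (c d : Comp L) (x : E) (y : F) :
    effros (c ⊗ₜ[ℂ] x) (d ⊗ₜ[ℂ] y) = compMul c d ⊗ₜ[ℂ] (x ⊗ₜ[ℂ] y) := rfl

theorem diamond_tmul (c d : Comp L) (x : E) (y : F) :
    diamond ι (c ⊗ₜ[ℂ] x) (d ⊗ₜ[ℂ] y) = compDiamond ι c d ⊗ₜ[ℂ] (x ⊗ₜ[ℂ] y) := rfl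

/-- The identity `a · (u ◇ v) · b = (a · (u ◇ 1)) ⊙ ((1 ◇ v) · b)`, from which the comparison of
the two norms follows. -/
theorem outerL_outerR_diamond (a b : Comp L) (u : Amp L E) (v : Amp L F) :
    outerL (a : L →L[ℂ] L) (outerR (b : L →L[ℂ] L) (diamond ι u v))
      = effros ((mulAmpl ι a).rTensor E u) ((amplMul ι b).rTensor F v) := by
  induction u using TensorProduct.induction_on with
  | zero => simp
  | add u u' hu hu' => simp only [map_add, LinearMap.add_apply, hu, hu']
  | tmul c x =>
    induction v using TensorProduct.induction_on with
    | zero => simp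
    | add v v' hv hv' => simp only [map_add, hv, hv']
    | tmul d y =>
      rw [LinearMap.rTensor_tmul, LinearMap.rTensor_tmul, diamond_tmul, effros_tmul, outerR_tmul,
        outerL_tmul]
      congr 1
      refine Subtype.ext ?_
      have h : opDiamond ι (c : L →L[ℂ] L) d = opDiamond ι c 1 * opDiamond ι 1 d :=
        (isHilbertTensor_modelTensor ι).ext fun ξ η => by
          rw [mul_apply_eq_comp]
          simp only [opDiamond_modelTensor, one_apply_eq_self]
      change (a : L →L[ℂ] L) * (opDiamond ι c d * b)
        = (a * opDiamond ι c 1) * (opDiamond ι 1 d * b)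
      rw [h]
      noncomm_ring

variable {ι} {NE : Amp L E → ℝ} {NF : Amp L F → ℝ}

variable (ι NE NF) in
/-- The sums `∑ ‖a k‖ ‖u k‖ ‖v k‖ ‖b k‖` whose infimum is the value of `fourNorm` at `U`. -/
def fourSums (U : Amp L (E ⊗[ℂ] F)) : Set ℝ :=
  {r : ℝ | ∃ (n : ℕ) (a : Fin n → Comp L) (u : Fin n → Amp L E) (v : Fin n → Amp L F)
    (b : Fin n → Comp L),
    U = ∑ k, outerL (a k : L →L[ℂ] L) (outerR (b k : L →L[ℂ] L) (diamond ι (u k) (v k))) ∧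
    r = ∑ k, ‖a k‖ * NE (u k) * NF (v k) * ‖b k‖}

variable (NE NF) in
/-- The sums `∑ ‖u k‖ ‖v k‖` whose infimum is the value of `haagerupNorm` at `U`. -/
def haagerupSums (U : Amp L (E ⊗[ℂ] F)) : Set ℝ :=
  {r : ℝ | ∃ (n : ℕ) (u : Fin n → Amp L E) (v : Fin n → Amp L F),
    U = ∑ k, effros (u k) (v k) ∧ r = ∑ k, NE (u k) * NF (v k)}

theorem fourNorm_eq (U : Amp L (E ⊗[ℂ] F)) : fourNorm ι NE NF U = sInf (fourSums ι NE NF U) := rfl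

theorem add_mem_fourSums {U V : Amp L (E ⊗[ℂ] F)} {r s : ℝ} (hr : r ∈ fourSums ι NE NF U)
    (hs : s ∈ fourSums ι NE NF V) : r + s ∈ fourSums ι NE NF (U + V) := by
  obtain ⟨n, a, u, v, b, hU, rfl⟩ := hr
  obtain ⟨m, a', u', v', b', hV, rfl⟩ := hs
  refine ⟨n + m, Fin.append a a', Fin.append u u', Fin.append v v', Fin.append b b', ?_, ?_⟩
  · simp only [Fin.sum_univ_add, Fin.append_left, Fin.append_right]
    rw [hU, hV]
  · simp only [Fin.sum_univ_add, Fin.append_left, Fin.append_right]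

variable [CompleteSpace L]

theorem IsQuantumNorm.mulAmpl_le (hL : ¬ FiniteDimensional ℂ L) (hE : IsQuantumNorm NE)
    (a : Comp L) (u : Amp L E) : NE ((mulAmpl ι a).rTensor E u) ≤ ‖a‖ * NE u :=
  hE.rTensor_mul_ampl_le hL (isHilbertTensor_modelTensor ι)
    (A := fun c => opDiamond ι c 1)
    (fun _ => (norm_opDiamond_le ι _ _).trans
      (mul_le_of_le_one_right (norm_nonneg _) ContinuousLinearMap.norm_id_le))
    (fun _ ξ η => opDiamond_modelTensor ι _ _ ξ η) a (fun _ => rfl) u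

theorem IsQuantumNorm.amplMul_le (hL : ¬ FiniteDimensional ℂ L) (hF : IsQuantumNorm NF)
    (b : Comp L) (v : Amp L F) : NF ((amplMul ι b).rTensor F v) ≤ ‖b‖ * NF v :=
  hF.rTensor_ampl_mul_le hL (isHilbertTensor_modelTensor ι).flip
    (A := fun c => opDiamond ι 1 c)
    (fun _ => (norm_opDiamond_le ι _ _).trans
      (mul_le_of_le_one_left (norm_nonneg _) ContinuousLinearMap.norm_id_le))
    (fun _ ξ η => opDiamond_modelTensor ι _ _ η ξ) b (fun _ => rfl) v

theorem nonneg_of_mem_haagerupSums (hE : IsQuantumNorm NE) (hF : IsQuantumNorm NF)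
    {U : Amp L (E ⊗[ℂ] F)} {r : ℝ} (hr : r ∈ haagerupSums NE NF U) : 0 ≤ r := by
  obtain ⟨n, u, v, -, rfl⟩ := hr
  exact Finset.sum_nonneg fun k _ => mul_nonneg (hE.nonneg _) (hF.nonneg _)

theorem nonneg_of_mem_fourSums (hE : IsQuantumNorm NE) (hF : IsQuantumNorm NF)
    {U : Amp L (E ⊗[ℂ] F)} {r : ℝ} (hr : r ∈ fourSums ι NE NF U) : 0 ≤ r := by
  obtain ⟨n, a, u, v, b, -, rfl⟩ := hr
  exact Finset.sum_nonneg fun k _ => mul_nonneg (mul_nonneg (mul_nonneg (norm_nonneg _)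
    (hE.nonneg _)) (hF.nonneg _)) (norm_nonneg _)

theorem exists_mem_haagerupSums_le (hL : ¬ FiniteDimensional ℂ L) (hE : IsQuantumNorm NE)
    (hF : IsQuantumNorm NF) {U : Amp L (E ⊗[ℂ] F)} {r : ℝ} (hr : r ∈ fourSums ι NE NF U) :
    ∃ r' ∈ haagerupSums NE NF U, r' ≤ r := by
  obtain ⟨n, a, u, v, b, hU, rfl⟩ := hr
  refine ⟨_, ⟨n, fun k => (mulAmpl ι (a k)).rTensor E (u k),
    fun k => (amplMul ι (b k)).rTensor F (v k), ?_, rfl⟩, ?_⟩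
  · rw [hU]
    exact Finset.sum_congr rfl fun k _ => outerL_outerR_diamond ι _ _ _ _
  · refine Finset.sum_le_sum fun k _ => ?_
    calc _ ≤ (‖a k‖ * NE (u k)) * (‖b k‖ * NF (v k)) :=
          mul_le_mul (hE.mulAmpl_le hL _ _) (hF.amplMul_le hL _ _) (hF.nonneg _)
            (mul_nonneg (norm_nonneg _) (hE.nonneg _))
      _ = ‖a k‖ * NE (u k) * NF (v k) * ‖b k‖ := by ring

theorem smul_mem_fourSums (hE : IsQuantumNorm NE) {U : Amp L (E ⊗[ℂ] F)} {r : ℝ} (c : ℂ)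
    (hr : r ∈ fourSums ι NE NF U) : ‖c‖ * r ∈ fourSums ι NE NF (c • U) := by
  obtain ⟨n, a, u, v, b, hU, rfl⟩ := hr
  refine ⟨n, a, fun k => c • u k, v, b, ?_, ?_⟩
  · rw [hU, Finset.smul_sum]
    simp only [map_smul, LinearMap.smul_apply]
  · rw [Finset.mul_sum]
    refine Finset.sum_congr rfl fun k _ => ?_
    rw [hE.smul]
    ring

/-- Every element of the amplification has a representation as in the definition of `fourNorm`:
a compact operator is a product `a e b` of compact operators, and `e = S* (e ◇ p) S` for a rank one
projection `p` and an isometry `S`. -/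
theorem fourSums_nonempty (hL : ¬ FiniteDimensional ℂ L) (U : Amp L (E ⊗[ℂ] F)) :
    (fourSums ι NE NF U).Nonempty := by
  induction U using TensorProduct.induction_on with
  | zero => exact ⟨0, 0, Fin.elim0, Fin.elim0, Fin.elim0, Fin.elim0, by simp, by simp⟩
  | add U V hU hV =>
    obtain ⟨r, hr⟩ := hU
    obtain ⟨s, hs⟩ := hV
    exact ⟨_, add_mem_fourSums hr hs⟩
  | tmul c t =>
    induction t using TensorProduct.induction_on with
    | zero => exact ⟨0, 0, Fin.elim0, Fin.elim0, Fin.elim0, Fin.elim0, by simp, by simp⟩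
    | add t t' ht ht' =>
      obtain ⟨r, hr⟩ := ht
      obtain ⟨s, hs⟩ := ht'
      rw [TensorProduct.tmul_add]
      exact ⟨_, add_mem_fourSums hr hs⟩
    | tmul x y =>
      have hβ := isHilbertTensor_modelTensor ι
      obtain ⟨e, he⟩ := exists_orthonormal_nat hL
      have hS := hβ.isIsometryFamily_slot he
      set S := hβ.slot (e 0)
      obtain ⟨a, d, b, ha, hd, hb, hc⟩ := exists_compact_mul_mul hS c.2
      let p : L →L[ℂ] L := InnerProductSpace.rankOne ℂ (e 0) (e 0)
      have hp : IsCompactOperator p := isCompactOperator_of_finite (Submodule.span ℂ {e 0}) p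
        fun z => Submodule.smul_mem _ _ (Submodule.mem_span_singleton_self _)
      refine ⟨_, 1, fun _ => ⟨a * star S, ha.comp_clm _⟩, fun _ => (⟨d, hd⟩ : Comp L) ⊗ₜ x,
        fun _ => (⟨p, hp⟩ : Comp L) ⊗ₜ y, fun _ => ⟨S * b, hb.clm_comp S⟩, ?_, rfl⟩
      rw [Fin.sum_univ_one, diamond_tmul, outerR_tmul, outerL_tmul]
      congr 1
      refine Subtype.ext ?_
      change (c : L →L[ℂ] L) = a * star S * (opDiamond ι d p * (S * b))
      have h1 : opDiamond ι d p * S = S * d := by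
        ext ξ
        change opDiamond ι d p (modelTensor ι ξ (e 0)) = modelTensor ι (d ξ) (e 0)
        rw [opDiamond_modelTensor, InnerProductSpace.rankOne_apply, inner_self_eq_norm_sq_to_K,
          he.1 0]
        simp
      have h2 : star S * S = 1 := hS.star_mul_self 0
      rw [show a * star S * (opDiamond ι d p * (S * b)) = a * star S * (opDiamond ι d p * S) * b
        by noncomm_ring, h1, show a * star S * (S * d) * b = a * (star S * S) * d * b
        by noncomm_ring, h2, mul_one, hc]

theorem haagerupNorm_le_fourNorm (hL : ¬ FiniteDimensional ℂ L) (hE : IsQuantumNorm NE)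
    (hF : IsQuantumNorm NF) (U : Amp L (E ⊗[ℂ] F)) :
    haagerupNorm NE NF U ≤ fourNorm ι NE NF U := by
  refine le_csInf (fourSums_nonempty hL U) fun r hr => ?_
  obtain ⟨r', hr', hle⟩ := exists_mem_haagerupSums_le hL hE hF hr
  exact (csInf_le ⟨0, fun _ => nonneg_of_mem_haagerupSums hE hF⟩ hr').trans hle

end Comparison

/-! ### Definiteness of the Haagerup norm -/

section Definiteness

variable {L : Type*} [NormedAddCommGroup L] [InnerProductSpace ℂ L]
variable {E F : Type*} [AddCommGroup E] [Module ℂ E] [AddCommGroup F] [Module ℂ F]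

/-- The amplification `c ⊗ x ↦ f x • c` of a linear functional `f`. -/
noncomputable def amplFunctional (f : E →ₗ[ℂ] ℂ) : Amp L E →ₗ[ℂ] Comp L :=
  (TensorProduct.rid ℂ (Comp L)).toLinearMap ∘ₗ f.lTensor (Comp L)

@[simp]
theorem amplFunctional_tmul (f : E →ₗ[ℂ] ℂ) (c : Comp L) (x : E) :
    amplFunctional f (c ⊗ₜ x) = f x • c := by
  simp [amplFunctional]

/-- The functional `x ⊗ y ↦ f x * g y`. -/
noncomputable def functionalTensor (f : E →ₗ[ℂ] ℂ) (g : F →ₗ[ℂ] ℂ) : E ⊗[ℂ] F →ₗ[ℂ] ℂ :=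
  LinearMap.mul' ℂ ℂ ∘ₗ TensorProduct.map f g

theorem coe_amplFunctional_effros (f : E →ₗ[ℂ] ℂ) (g : F →ₗ[ℂ] ℂ) (u : Amp L E) (v : Amp L F) :
    (amplFunctional (functionalTensor f g) (effros u v) : L →L[ℂ] L)
      = (amplFunctional f u : L →L[ℂ] L) * (amplFunctional g v : L →L[ℂ] L) := by
  induction u using TensorProduct.induction_on with
  | zero => simp
  | add u u' hu hu' =>
    simp only [map_add, LinearMap.add_apply, Submodule.coe_add, hu, hu', add_mul]
  | tmul c x =>
    induction v using TensorProduct.induction_on with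
    | zero => simp
    | add v v' hv hv' => simp only [map_add, Submodule.coe_add, hv, hv', mul_add]
    | tmul d y =>
      rw [effros_tmul, amplFunctional_tmul, amplFunctional_tmul, amplFunctional_tmul]
      simp [functionalTensor, compMul, smul_smul, mul_comm]

/-- Functionals `φ` that separate the points of `W` separate, by the maps `id ⊗ φ`, the points of
`V ⊗ W`. -/
theorem eq_zero_of_lTensor_eq_zero {V W : Type*} [AddCommGroup V] [Module ℂ V] [AddCommGroup W]
    [Module ℂ W] {D : Set (W →ₗ[ℂ] ℂ)} (hD : ∀ w, (∀ φ ∈ D, φ w = 0) → w = 0)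
    {t : V ⊗[ℂ] W} (ht : ∀ φ ∈ D, φ.lTensor V t = 0) : t = 0 := by
  classical
  let B := Module.Basis.ofVectorSpace ℂ V
  have key : ∀ (φ : W →ₗ[ℂ] ℂ) (t : V ⊗[ℂ] W) i,
      φ (TensorProduct.equivFinsuppOfBasisLeft B t i)
        = TensorProduct.equivFinsuppOfBasisLeft B (φ.lTensor V t) i := by
    intro φ t i
    induction t using TensorProduct.induction_on with
    | zero => simp
    | add t t' ht ht' => simp only [map_add, Finsupp.add_apply, ht, ht']
    | tmul v w => simp
  refine (TensorProduct.equivFinsuppOfBasisLeft B).map_eq_zero_iff.1 ?_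
  ext i
  refine hD _ fun φ hφ => ?_
  rw [key, ht φ hφ]
  simp

theorem IsNorm.exists_functional {X : Type*} [AddCommGroup X] [Module ℂ X] {N : X → ℝ}
    (hN : IsNorm N) {x : X} (hx : x ≠ 0) :
    ∃ f : X →ₗ[ℂ] ℂ, (∀ y, ‖f y‖ ≤ N y) ∧ f x ≠ 0 := by
  let _ : Norm X := ⟨N⟩
  have core : NormedSpace.Core ℂ X :=
    { norm_nonneg := hN.nonneg
      norm_smul := hN.smul
      norm_triangle := hN.add_le
      norm_eq_zero_iff := hN.eq_zero_iff }
  let _ : NormedAddCommGroup X := NormedAddCommGroup.ofCore core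
  let _ : NormedSpace ℂ X := NormedSpace.ofCore core
  obtain ⟨g, hg, hgx⟩ := exists_dual_vector ℂ x (norm_ne_zero_iff.2 hx)
  refine ⟨g.toLinearMap, fun y => ?_, ?_⟩
  · have := g.le_opNorm y
    rwa [hg, one_mul] at this
  · change g x ≠ 0
    rw [hgx]
    exact Complex.ofReal_ne_zero.2 (norm_ne_zero_iff.2 hx)

/-- The rank one operator `z ↦ ⟪η, z⟫ ξ`, as a compact operator. -/
noncomputable def compRankOne (ξ η : L) : Comp L :=
  ⟨InnerProductSpace.rankOne ℂ ξ η, isCompactOperator_of_finite (Submodule.span ℂ {ξ}) _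
    fun _ => Submodule.smul_mem _ _ (Submodule.mem_span_singleton_self _)⟩

variable [CompleteSpace L] {NE : Amp L E → ℝ} {NF : Amp L F → ℝ}

/-- A quantum norm on `E` restricts to a norm on `E`, embedded by `x ↦ p ⊗ x` for a rank one
projection `p`. -/
theorem IsQuantumNorm.isNorm_underlying (hE : IsQuantumNorm NE) {e : L} (he : ‖e‖ = 1) :
    IsNorm fun x : E => NE (compRankOne e e ⊗ₜ x) where
  nonneg _ := hE.nonneg _
  eq_zero_iff x := by
    rw [hE.eq_zero_iff]
    refine ⟨fun h => ?_, fun h => by rw [h, TensorProduct.tmul_zero]⟩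
    let φ : Comp L →ₗ[ℂ] ℂ :=
      (innerSL ℂ e).toLinearMap ∘ₗ (ContinuousLinearMap.apply ℂ L e).toLinearMap ∘ₗ
        (Comp L).subtype
    have h1 := congrArg (fun t => TensorProduct.lid ℂ E (φ.rTensor E t)) h
    have h2 : φ (compRankOne e e) = 1 := by
      change inner ℂ e (inner ℂ e e • e) = (1 : ℂ)
      rw [inner_smul_right, inner_self_eq_norm_sq_to_K, he]
      simp
    simpa [h2] using h1
  smul c x := by rw [TensorProduct.tmul_smul, hE.smul]
  add_le x y := by rw [TensorProduct.tmul_add]; exact hE.add_le _ _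

/-- A functional that is contractive for the norm `x ↦ ‖p ⊗ x‖` of `E`, where `p` is a rank one
projection, is completely contractive: the matrix coefficients of `amplFunctional f u` are values
of `f` at points `x` such that `p ⊗ x` is a compression of `u`. -/
theorem IsQuantumNorm.norm_amplFunctional_le (hE : IsQuantumNorm NE) {e : L} (he : ‖e‖ = 1)
    {f : E →ₗ[ℂ] ℂ} (hf : ∀ x, ‖f x‖ ≤ NE (compRankOne e e ⊗ₜ x)) (u : Amp L E) :
    ‖amplFunctional f u‖ ≤ NE u := by
  have key : ∀ ξ η : L, ∃ x : E,
      outerL (InnerProductSpace.rankOne ℂ e η) (outerR (InnerProductSpace.rankOne ℂ ξ e) u)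
        = compRankOne e e ⊗ₜ x ∧
      f x = inner ℂ η ((amplFunctional f u : L →L[ℂ] L) ξ) := by
    intro ξ η
    induction u using TensorProduct.induction_on with
    | zero => exact ⟨0, by simp, by simp⟩
    | add u v hu hv =>
      obtain ⟨x, hx, hfx⟩ := hu
      obtain ⟨y, hy, hfy⟩ := hv
      refine ⟨x + y, ?_, ?_⟩
      · rw [map_add, map_add, hx, hy, TensorProduct.tmul_add]
      · rw [map_add, hfx, hfy, map_add, Submodule.coe_add, add_apply, inner_add_right]
    | tmul c x =>
      refine ⟨inner ℂ η ((c : L →L[ℂ] L) ξ) • x, ?_, ?_⟩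
      · rw [outerR_tmul, outerL_tmul, ← TensorProduct.smul_tmul]
        congr 1
        refine Subtype.ext (ContinuousLinearMap.ext fun z => ?_)
        change inner ℂ η ((c : L →L[ℂ] L) (inner ℂ e z • ξ)) • e
          = inner ℂ η ((c : L →L[ℂ] L) ξ) • inner ℂ e z • e
        rw [map_smul, inner_smul_right, smul_smul, mul_comm]
      · rw [amplFunctional_tmul, map_smul, smul_eq_mul, Submodule.coe_smul, smul_apply,
          inner_smul_right, mul_comm]
  have hbound : ∀ ξ η : L, ‖inner ℂ η ((amplFunctional f u : L →L[ℂ] L) ξ)‖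
      ≤ ‖η‖ * (‖ξ‖ * NE u) := by
    intro ξ η
    obtain ⟨x, hx, hfx⟩ := key ξ η
    rw [← hfx]
    refine (hf x).trans ?_
    rw [← hx]
    refine (hE.outerL_le _ _).trans ?_
    rw [InnerProductSpace.norm_rankOne, he, one_mul]
    refine mul_le_mul_of_nonneg_left ((hE.outerR_le _ _).trans ?_) (norm_nonneg _)
    rw [InnerProductSpace.norm_rankOne, he, mul_one]
  refine ContinuousLinearMap.opNorm_le_bound _ (hE.nonneg u) fun ξ => ?_
  set y := (amplFunctional f u : L →L[ℂ] L) ξ with hy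
  change ‖y‖ ≤ NE u * ‖ξ‖
  rcases (norm_nonneg y).eq_or_lt with h0 | h0
  · rw [← h0]
    exact mul_nonneg (hE.nonneg u) (norm_nonneg _)
  · have h1 := hbound ξ y
    rw [← hy, inner_self_eq_norm_sq_to_K, norm_pow, RCLike.norm_ofReal, abs_norm, sq] at h1
    rw [mul_comm]
    exact le_of_mul_le_mul_left h1 h0

/-- Products of completely contractive functionals are contractive for the Haagerup norm. -/
theorem norm_amplFunctional_le_of_mem_haagerupSums {f : E →ₗ[ℂ] ℂ} {g : F →ₗ[ℂ] ℂ}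
    (hf : ∀ u : Amp L E, ‖amplFunctional f u‖ ≤ NE u)
    (hg : ∀ v : Amp L F, ‖amplFunctional g v‖ ≤ NF v) {U : Amp L (E ⊗[ℂ] F)} {r : ℝ}
    (hr : r ∈ haagerupSums NE NF U) : ‖amplFunctional (functionalTensor f g) U‖ ≤ r := by
  obtain ⟨n, u, v, rfl, rfl⟩ := hr
  rw [map_sum]
  refine (norm_sum_le _ _).trans (Finset.sum_le_sum fun k _ => ?_)
  rw [Submodule.coe_norm, coe_amplFunctional_effros]
  exact (norm_mul_le _ _).trans
    (mul_le_mul (hf _) (hg _) (norm_nonneg _) ((norm_nonneg _).trans (hf _)))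

theorem eq_zero_of_haagerupNorm_eq_zero (hL : ¬ FiniteDimensional ℂ L) (hE : IsQuantumNorm NE)
    (hF : IsQuantumNorm NF) {U : Amp L (E ⊗[ℂ] F)} (hne : (haagerupSums NE NF U).Nonempty)
    (hU : haagerupNorm NE NF U = 0) : U = 0 := by
  obtain ⟨e', he'⟩ := exists_orthonormal_nat hL
  obtain ⟨e, he⟩ : ∃ e : L, ‖e‖ = 1 := ⟨e' 0, he'.1 0⟩
  let DE : Set (E →ₗ[ℂ] ℂ) := {f | ∀ x, ‖f x‖ ≤ NE (compRankOne e e ⊗ₜ x)}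
  let DF : Set (F →ₗ[ℂ] ℂ) := {g | ∀ y, ‖g y‖ ≤ NF (compRankOne e e ⊗ₜ y)}
  have hDE : ∀ x, (∀ f ∈ DE, f x = 0) → x = 0 := fun x hx => by
    by_contra h
    obtain ⟨f, hf, hfx⟩ := (hE.isNorm_underlying he).exists_functional h
    exact hfx (hx f hf)
  have hDF : ∀ y, (∀ g ∈ DF, g y = 0) → y = 0 := fun y hy => by
    by_contra h
    obtain ⟨g, hg, hgy⟩ := (hF.isNorm_underlying he).exists_functional h
    exact hgy (hy g hg)
  let D : Set (E ⊗[ℂ] F →ₗ[ℂ] ℂ) := {φ | ∃ f ∈ DE, ∃ g ∈ DF, functionalTensor f g = φ}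
  have hD : ∀ t, (∀ φ ∈ D, φ t = 0) → t = 0 := by
    intro t ht
    refine eq_zero_of_lTensor_eq_zero hDF fun g hg => ?_
    refine (TensorProduct.rid ℂ E).map_eq_zero_iff.1 (hDE _ fun f hf => ?_)
    rw [← ht _ ⟨f, hf, g, hg, rfl⟩]
    clear ht
    induction t using TensorProduct.induction_on with
    | zero => simp
    | add t t' h h' => simp only [map_add, h, h']
    | tmul x y => simp [functionalTensor, mul_comm]
  refine eq_zero_of_lTensor_eq_zero hD ?_
  rintro _ ⟨f, hf, g, hg, rfl⟩
  refine (TensorProduct.rid ℂ (Comp L)).map_eq_zero_iff.1 ?_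
  change amplFunctional (functionalTensor f g) U = 0
  refine norm_le_zero_iff.1 ?_
  rw [← hU]
  exact le_csInf hne fun r hr => norm_amplFunctional_le_of_mem_haagerupSums
    (hE.norm_amplFunctional_le he hf) (hF.norm_amplFunctional_le he hg) hr

theorem isNorm_fourNorm {ι : L ≃ₗᵢ[ℂ] HilbertSquare L} (hL : ¬ FiniteDimensional ℂ L)
    (hE : IsQuantumNorm NE) (hF : IsQuantumNorm NF) :
    IsNorm (fourNorm (L := L) (E := E) (F := F) ι NE NF) := by
  have hbdd : ∀ U : Amp L (E ⊗[ℂ] F), BddBelow (fourSums ι NE NF U) :=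
    fun U => ⟨0, fun _ => nonneg_of_mem_fourSums hE hF⟩
  have hnonneg : ∀ U, 0 ≤ fourNorm ι NE NF U :=
    fun U => Real.sInf_nonneg fun _ => nonneg_of_mem_fourSums hE hF
  have hzero : fourNorm ι NE NF (0 : Amp L (E ⊗[ℂ] F)) = 0 :=
    le_antisymm (csInf_le (hbdd 0)
      ⟨0, Fin.elim0, Fin.elim0, Fin.elim0, Fin.elim0, by simp, by simp⟩) (hnonneg 0)
  have hsmul : ∀ (c : ℂ) U, fourNorm ι NE NF (c • U) ≤ ‖c‖ * fourNorm ι NE NF U := by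
    intro c U
    rw [fourNorm_eq U, ← smul_eq_mul, ← Real.sInf_smul_of_nonneg (norm_nonneg c)]
    refine le_csInf ((fourSums_nonempty hL U).smul_set) ?_
    rintro _ ⟨r, hr, rfl⟩
    exact csInf_le (hbdd _) (smul_mem_fourSums hE c hr)
  refine ⟨hnonneg, fun U => ⟨fun hU => ?_, fun hU => by rw [hU, hzero]⟩, fun c U => ?_,
    fun U V => ?_⟩
  · obtain ⟨r, hr⟩ := fourSums_nonempty (ι := ι) (NE := NE) (NF := NF) hL U
    obtain ⟨r', hr', -⟩ := exists_mem_haagerupSums_le hL hE hF hr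
    refine eq_zero_of_haagerupNorm_eq_zero hL hE hF ⟨r', hr'⟩ (le_antisymm ?_ ?_)
    · exact (haagerupNorm_le_fourNorm hL hE hF U).trans hU.le
    · exact Real.sInf_nonneg fun _ => nonneg_of_mem_haagerupSums hE hF
  · refine le_antisymm (hsmul c U) ?_
    rcases eq_or_ne c 0 with rfl | hc
    · simp [hzero]
    · have h := hsmul c⁻¹ (c • U)
      rw [smul_smul, inv_mul_cancel₀ hc, one_smul, norm_inv] at h
      rwa [← le_inv_mul_iff₀ (norm_pos_iff.2 hc)]
  · refine le_of_forall_pos_le_add fun ε hε => ?_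
    obtain ⟨r, hr, hrU⟩ := Real.lt_sInf_add_pos (fourSums_nonempty (ι := ι) (NE := NE) (NF := NF)
      hL U) (half_pos hε)
    obtain ⟨s, hs, hsV⟩ := Real.lt_sInf_add_pos (fourSums_nonempty (ι := ι) (NE := NE) (NF := NF)
      hL V) (half_pos hε)
    rw [← fourNorm_eq] at hrU hsV
    linarith [csInf_le (hbdd _) (add_mem_fourSums hr hs), fourNorm_eq (ι := ι) (NE := NE)
      (NF := NF) (U + V)]

end Definiteness

end QuantumTensor

theorem proposition23
    {L : Type*} [NormedAddCommGroup L] [InnerProductSpace ℂ L] [CompleteSpace L]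
    [TopologicalSpace.SeparableSpace L] (hL : ¬ FiniteDimensional ℂ L)
    (ι : L ≃ₗᵢ[ℂ] QuantumTensor.HilbertSquare L)
    {E F : Type*} [AddCommGroup E] [Module ℂ E] [AddCommGroup F] [Module ℂ F]
    (NE : QuantumTensor.Amp L E → ℝ) (hE : QuantumTensor.IsQuantumNorm NE)
    (NF : QuantumTensor.Amp L F → ℝ) (hF : QuantumTensor.IsQuantumNorm NF) :
    (∀ U : QuantumTensor.Amp L (E ⊗[ℂ] F),
      QuantumTensor.haagerupNorm NE NF U ≤ QuantumTensor.fourNorm ι NE NF U) ∧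
    QuantumTensor.IsNorm (QuantumTensor.fourNorm (L := L) (E := E) (F := F) ι NE NF) := by
  exact ⟨QuantumTensor.haagerupNorm_le_fourNorm hL hE hF, QuantumTensor.isNorm_fourNorm hL hE hF⟩
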